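/- Let $k$ be a field of characteristic $0$ and let $m \ge 0$. Let $\mathrm{FI}^m$ be the $m$-fold product of the category of finite sets and injections, and $\mathrm{FI}\sharp^m \supset \mathrm{FI}^m$ the $m$-fold product of the category of finite sets and partially defined injections. An $\mathrm{FI}^m$-module is a functor $V$ from $\mathrm{FI}^m$ to $k$-vector spaces; it is finitely generated if some finite set of elements of the spaces $V_{\mathbf d}$ is contained in no proper submodule. A graded $\mathrm{FI}^m$-module, graded by $\mathbb{N}$, is of finite type if each of its graded pieces is finitely generated. Tensor products of $\mathrm{FI}^m$-modules are taken pointwise, $(V\otimes V')_{\mathbf d}=V_{\mathbf d}\otimes V'_{\mathbf d}$. A graded $\mathrm{FI}^m$-algebra (or $\mathrm{FI}\sharp^m$-algebra) is a functor from $\mathrm{FI}^m$ (or $\mathrm{FI}\sharp^m$) to $\mathbb{N}$-graded, graded-commutative $k$-algebras. 1. If $V$ and $V'$ are finitely generated $\mathrm{FI}^m$-modules, then $V \otimes V'$ is finitely generated. 2. Let $A$ be a graded $\mathrm{FI}^m$-algebra and $V \subseteq A$ a graded $\mathrm{FI}^m$-submodule with $V^0 = 0$ such that each $A_{\mathbf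 d}$ is generated as a $k$-algebra by $V_{\mathbf d}$. If $V$ is of finite type, then $A$ is of finite type. 3. Let $V=\bigoplus_{i\ge 0}V^i$ be a graded vector space with $V^0 = k$. Let $V^{\otimes \bullet}$ be the graded $\mathrm{FI}\sharp^m$-module with $(V^{\otimes\bullet})_{\mathbf d} = \bigotimes_{i=1}^m V^{\otimes d_i}$, where a morphism $f : \mathbf c \to \mathbf d$ moves the tensor factor at $s$ to position $f(s)$ if $f$ is defined at $s$, applies the projection $V \to V^0 = k$ to that factor otherwise, and puts $1 \in k = V^0$ in the positions outside the image of $f$. If every $V^i$ is finite-dimensional, then $V^{\otimes \bullet}$ is of finite type as a graded $\mathrm{FI}^m$-module. 4. Let $X$ be a path-connected space with base point $x_0$ such that the singular cohomology $H^i(X;k)$ is finite-dimensional for every $i$. Let $X^\bullet$ be the functor $(\mathrm{FI}\sharp^m)^{\mathrm{op}} \to \mathrm{Top}$ with $X^{\mathbf d} = \prod_{i=1}^m X^{d_i}$, where $f : \mathbf c \to \mathbf d$ sends $v \in X^{\mathbf d}$ to the point of $X^{\mathbf c}$ whose coordinate at $s$ is $v_{f(s)}$ if $f$ is defined at $s$,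 and $x_0$ otherwise. Then $H^*(X^\bullet; k)$, with the cup product, is a graded $\mathrm{FI}\sharp^m$-algebra (in particular graded-commutative), and it is of finite type as a graded $\mathrm{FI}^m$-module. -/

import Mathlib

open CategoryTheory Opposite
open scoped TensorProduct DirectSum

universe u v v' w w'

noncomputable section

namespace FIRep

/-! ### The categories `FI^m` and `FI♯^m` -/

/-- Objects of `FI`: finite sets. -/
structure FI where
  carrier : Type
  [fintype : Fintype carrier]

attribute [instance] FI.fintype

instance : CoeSort FI Type := ⟨FI.carrier⟩

/-- Morphisms of `FI`: injections. -/
instance : Category FI where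
  Hom S T := S ↪ T
  id S := Function.Embedding.refl S
  comp f g := f.trans g

/-- Objects of `FI♯`: finite sets. -/
structure FISharp where
  carrier : Type
  [fintype : Fintype carrier]

attribute [instance] FISharp.fintype

instance : CoeSort FISharp Type := ⟨FISharp.carrier⟩

/-- Morphisms of `FI♯`: partially defined injections. -/
instance : Category FISharp where
  Hom S T := S ≃. T
  id S := PEquiv.refl S
  comp f g := f.trans g
  id_comp f := PEquiv.refl_trans f
  comp_id f := PEquiv.trans_refl f
  assoc f g h := PEquiv.trans_assoc f g h

open Classical in
/-- An injection, seen as an everywhere defined partial injection. -/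
def pequivOfEmbedding {S T : Type} (f : S ↪ T) : S ≃. T where
  toFun s := some (f s)
  invFun := Function.partialInv f
  inv s t := by
    have h := f.injective.isPartialInv s t
    simp only [h, Option.some.injEq]

/-- The inclusion of `FI` in `FI♯`. -/
def FI.toSharp : FI ⥤ FISharp where
  obj S := ⟨S⟩
  map f := pequivOfEmbedding f
  map_id _ := PEquiv.ext fun _ => rfl
  map_comp _ _ := PEquiv.ext fun _ => rfl

/-- The product category `FI^m`. -/
abbrev FIm (m : ℕ) := Fin m → FI

/-- The product category `FI♯^m`. -/
abbrev FISharpm (m : ℕ) := Fin m → FISharp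

/-- The inclusion of `FI^m` in `FI♯^m`. -/
def toSharpm (m : ℕ) : FIm m ⥤ FISharpm m := Functor.pi fun _ => FI.toSharp

/-! ### Modules over a category -/

section Modules

variable {k : Type u} [Field k] {C : Type v} [Category.{v'} C]

/-- Submodules of a functor `V` from `C` to `k`-modules: families of subspaces `N c ⊆ V c` that
are stable under the maps of `V`. -/
structure SubMod (V : C ⥤ ModuleCat.{w} k) where
  carrier : ∀ c, Submodule k (V.obj c)
  map_mem : ∀ {c d : C} (f : c ⟶ d) (x : V.obj c), x ∈ carrier c → (V.map f).hom x ∈ carrier d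

/-- A submodule is itself a functor. -/
def SubMod.toFunctor {V : C ⥤ ModuleCat.{w} k} (N : SubMod V) : C ⥤ ModuleCat.{w} k where
  obj c := ModuleCat.of k (N.carrier c)
  map f := ModuleCat.ofHom ((V.map f).hom.restrict (N.map_mem f))
  map_id c := by ext x; simp
  map_comp f g := by ext x; simp

/-- `V` is finitely generated: some finite set of elements of `V` lies in no proper submodule. -/
def FinGen (V : C ⥤ ModuleCat.{w} k) : Prop :=
  ∃ s : Set (Σ c, V.obj c), s.Finite ∧
    ∀ N : SubMod V, (∀ x ∈ s, x.2 ∈ N.carrier x.1) → ∀ c, N.carrier c = ⊤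

/-- The pointwise tensor product, on which `C` acts diagonally. -/
def tensor (V : C ⥤ ModuleCat.{w} k) (V' : C ⥤ ModuleCat.{w'} k) :
    C ⥤ ModuleCat.{max w w'} k where
  obj c := ModuleCat.of k (V.obj c ⊗[k] V'.obj c)
  map f := ModuleCat.ofHom (TensorProduct.map (V.map f).hom (V'.map f).hom)
  map_id c := by ext; simp
  map_comp f g := by ext; simp

/-- A functor to graded modules has finite type if each of its graded pieces is finitely
generated. -/
def FiniteType (V : C ⥤ GradedObject ℕ (ModuleCat.{w} k)) : Prop :=
  ∀ n : ℕ, FinGen (V ⋙ GradedObject.eval n)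

end Modules

/-! ### Graded algebras -/

/-- Graded `k`-algebras (associative and unital, graded by `ℕ`). -/
structure GrAlg (k : Type u) [Field k] where
  carrier : Type w
  [ring : Ring carrier]
  [algebra : Algebra k carrier]
  grading : ℕ → Submodule k carrier
  [gradedAlgebra : GradedAlgebra grading]

attribute [instance] GrAlg.ring GrAlg.algebra GrAlg.gradedAlgebra

section GradedAlgebras

variable {k : Type u} [Field k] {C : Type v} [Category.{v'} C]

/-- Morphisms of graded algebras: algebra homomorphisms that preserve degrees. -/
instance : Category (GrAlg.{u, w} k) where
  Hom A B := A.grading →ₐᵍ[k] B.grading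
  id A := GradedAlgHom.id k A.grading
  comp f g := g.comp f

/-- `ab = (-1)^{ij} ba` for `a` of degree `i` and `b` of degree `j`. -/
def GrAlg.IsGradedCommutative (A : GrAlg.{u, w} k) : Prop :=
  ∀ (i j : ℕ) (a b : A.carrier), a ∈ A.grading i → b ∈ A.grading j →
    a * b = (-1) ^ (i * j) * (b * a)

/-- The graded module underlying a graded algebra. -/
def GrAlg.toGradedModule : GrAlg.{u, w} k ⥤ GradedObject ℕ (ModuleCat.{w} k) where
  obj A := fun n => ModuleCat.of k (A.grading n)
  map {A B} (f : A.grading →ₐᵍ[k] B.grading) := fun n =>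
    ModuleCat.ofHom (f.toAlgHom.toLinearMap.restrict fun _ hx => f.map_mem hx)

/-- `A` is generated as an algebra by the graded submodule whose degree `i` piece is `V i`:
each `A c` is generated as a `k`-algebra by the union over `i` of the `V i c`. -/
def GeneratedBy (A : C ⥤ GrAlg.{u, w} k)
    (V : ∀ i : ℕ, SubMod (A ⋙ GrAlg.toGradedModule ⋙ GradedObject.eval i)) : Prop :=
  ∀ c : C, Algebra.adjoin k
    {a | ∃ (i : ℕ) (x : (A.obj c).grading i), x ∈ (V i).carrier c ∧ (x : (A.obj c).carrier) = a} = ⊤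

end GradedAlgebras

/-! ### Tensor powers of a graded vector space with degree `0` part `k` -/

section TensorPowers

variable {k : Type u} [Field k]

/-- The degree `n` part of `⨂ i, M i`, where `M i` has degree `j` part `𝒱 i j`: it is spanned by
the tensors of homogeneous elements whose degrees add up to `n`. -/
def tensorDegree {ι : Type} [Fintype ι] {M : ι → Type w} [∀ i, AddCommMonoid (M i)]
    [∀ i, Module k (M i)] (𝒱 : ∀ i, ℕ → Submodule k (M i)) (n : ℕ) :
    Submodule k (⨂[k] i, M i) :=
  Submodule.span k {z | ∃ (e : ι → ℕ) (x : ∀ i, M i),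
    (∀ i, x i ∈ 𝒱 i (e i)) ∧ ∑ i, e i = n ∧ z = PiTensorProduct.tprod k x}

lemma tensorDegree_map {ι : Type} [Fintype ι] {M N : ι → Type w} [∀ i, AddCommMonoid (M i)]
    [∀ i, Module k (M i)] [∀ i, AddCommMonoid (N i)] [∀ i, Module k (N i)]
    (𝒱 : ∀ i, ℕ → Submodule k (M i)) (𝒲 : ∀ i, ℕ → Submodule k (N i))
    (f : ∀ i, M i →ₗ[k] N i) (hf : ∀ i n, ∀ x ∈ 𝒱 i n, f i x ∈ 𝒲 i n) (n : ℕ) :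
    ∀ x ∈ tensorDegree 𝒱 n, PiTensorProduct.map f x ∈ tensorDegree 𝒲 n := by
  intro x hx
  change x ∈ (tensorDegree 𝒲 n).comap (PiTensorProduct.map f)
  revert x
  change tensorDegree 𝒱 n ≤ _
  refine Submodule.span_le.2 ?_
  rintro _ ⟨e, x, hx, he, rfl⟩
  simp only [SetLike.mem_coe, Submodule.mem_comap, PiTensorProduct.map_tprod]
  exact Submodule.subset_span ⟨e, _, fun i => hf i _ _ (hx i), he, rfl⟩

variable {W : Type w} [AddCommGroup W] [Module k W] (ε : W →ₗ[k] k) (u : W)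

lemma prod_update {S T : Type} [Fintype S] [DecidableEq S] (f : S ≃. T) (x : S → W) (s : S)
    (a : W) : (∏ r, if (f r).isSome then (1 : k) else ε (Function.update x s a r)) =
      (if (f s).isSome then 1 else ε a) *
        ∏ r ∈ Finset.univ.erase s, if (f r).isSome then (1 : k) else ε (x r) := by
  rw [← Finset.mul_prod_erase _ _ (Finset.mem_univ s), Function.update_self]
  congr 1
  refine Finset.prod_congr rfl fun r hr => ?_
  rw [Function.update_of_ne (Finset.ne_of_mem_erase hr)]

lemma elim_update_none {S T : Type} [DecidableEq S] {W : Type w} (f : S ≃. T) (u : W) {x : S → W} {s : S}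
    (hs : f s = none) (a : W) :
    (fun t => (f.symm t).elim u (Function.update x s a)) = fun t => (f.symm t).elim u x := by
  funext t
  rcases ht : f.symm t with _ | r
  · rfl
  · have hr : r ≠ s := by
      rintro rfl
      rw [f.eq_some_iff.1 ht] at hs
      cases hs
    simp [Function.update_of_ne hr]

open Classical in
lemma elim_update_some {S T : Type} [DecidableEq S] {W : Type w} (f : S ≃. T) (u : W) {x : S → W} {s : S}
    {t : T} (hs : f s = some t) (a : W) :
    (fun t => (f.symm t).elim u (Function.update x s a)) =
      Function.update (fun t => (f.symm t).elim u x) t a := by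
  funext t'
  by_cases h : t' = t
  · subst h
    simp [f.eq_some_iff.2 hs]
  · rw [Function.update_of_ne h]
    rcases ht : f.symm t' with _ | r
    · rfl
    · have hr : r ≠ s := by
        rintro rfl
        rw [f.eq_some_iff.1 ht] at hs
        exact h (Option.some.inj hs)
      simp [Function.update_of_ne hr]

/-- The map `W^{⊗S} → W^{⊗T}` of a partial injection `f : S → T`, given `u : W` and
`ε : W → k`: the tensor factor at `s` moves to position `f s` if `f` is defined at `s`,
and is contracted with `ε` otherwise; the positions outside the image of `f` receive `u`. -/
def sharpMap {S T : Type} [Fintype S] [Fintype T] (f : S ≃. T) :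
    (⨂[k] _ : S, W) →ₗ[k] (⨂[k] _ : T, W) :=
  PiTensorProduct.lift
    { toFun := fun x => (∏ s, if (f s).isSome then 1 else ε (x s)) •
        PiTensorProduct.tprod k fun t => (f.symm t).elim u x
      map_update_add' := by
        intro _ x s a b
        simp only [prod_update]
        rcases hs : f s with _ | t
        · simp [add_mul, add_smul, elim_update_none f u hs]
        · simp [elim_update_some f u hs]
      map_update_smul' := by
        intro _ x s c a
        simp only [prod_update]
        rcases hs : f s with _ | t
        · simp [mul_assoc, mul_smul, elim_update_none f u hs]
        · simp [elim_update_some f u hs, smul_comm c] }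

lemma sharpMap_tprod {S T : Type} [Fintype S] [Fintype T] (f : S ≃. T) (x : S → W) :
    sharpMap ε u f (PiTensorProduct.tprod k x) =
      (∏ s, if (f s).isSome then 1 else ε (x s)) •
        PiTensorProduct.tprod k fun t => (f.symm t).elim u x :=
  PiTensorProduct.lift.tprod x

lemma sharpMap_refl {S : Type} [Fintype S] :
    sharpMap ε u (PEquiv.refl S) = LinearMap.id := by
  ext x
  simp [sharpMap_tprod]

lemma sharpMap_trans (hu : ε u = 1) {S T R : Type} [Fintype S] [Fintype T] [Fintype R]
    (f : S ≃. T) (g : T ≃. R) :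
    sharpMap ε u (f.trans g) = sharpMap ε u g ∘ₗ sharpMap ε u f := by
  ext x
  simp only [LinearMap.compMultilinearMap_apply, LinearMap.comp_apply, sharpMap_tprod, map_smul,
    smul_smul]
  congr 1
  · have h1 : (∏ t, if (g t).isSome then (1 : k) else ε ((f.symm t).elim u x)) =
        ∏ s, if (f s).isSome then (if ((f s).bind g).isSome then 1 else ε (x s)) else 1 := by
      symm
      refine Finset.prod_bij_ne_one (fun s _ hs => (f s).get
        (by by_contra h0; simp [h0] at hs)) (fun _ _ _ => Finset.mem_univ _) ?_ ?_ ?_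
      · intro a _ ha b _ hb hab
        exact f.inj (Option.get_mem _) (hab.symm ▸ Option.get_mem _)
      · intro t _ ht
        rcases hs : f.symm t with _ | r
        · simp [hs, hu] at ht
        · have hr := f.eq_some_iff.1 hs
          refine ⟨r, Finset.mem_univ _, by simpa [hs, hr] using ht, ?_⟩
          simp [hr]
      · intro s _ hs
        obtain ⟨t, h0⟩ : ∃ t, f s = some t := by
          rcases h0 : f s with _ | t
          · simp [h0] at hs
          · exact ⟨t, rfl⟩
        simp [h0, f.eq_some_iff.2 h0]
    rw [h1, ← Finset.prod_mul_distrib]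
    refine Finset.prod_congr rfl fun s _ => ?_
    rcases h0 : f s with _ | t
    · simp [PEquiv.trans, h0]
    · simp [PEquiv.trans, h0]
  · congr 1
    funext r
    have h2 : (f.trans g).symm r = (g.symm r).bind f.symm := by
      rw [PEquiv.symm_trans_rev]
      rfl
    rw [h2]
    rcases g.symm r with _ | t <;> rfl

lemma sharpMap_degree (𝒱 : ℕ → Submodule k W) (hu : u ∈ 𝒱 0)
    (hε : ∀ n ≠ 0, ∀ x ∈ 𝒱 n, ε x = 0) {S T : Type} [Fintype S] [Fintype T] (f : S ≃. T)
    (n : ℕ) : ∀ x ∈ tensorDegree (fun _ : S => 𝒱) n,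
      sharpMap ε u f x ∈ tensorDegree (fun _ : T => 𝒱) n := by
  intro x hx
  change x ∈ (tensorDegree (fun _ : T => 𝒱) n).comap (sharpMap ε u f)
  revert x
  change tensorDegree _ n ≤ _
  refine Submodule.span_le.2 ?_
  rintro _ ⟨e, x, hx, he, rfl⟩
  simp only [SetLike.mem_coe, Submodule.mem_comap, sharpMap_tprod]
  by_cases h : ∃ s, f s = none ∧ e s ≠ 0
  · obtain ⟨s, hs, hes⟩ := h
    rw [Finset.prod_eq_zero (Finset.mem_univ s) (by simp [hs, hε _ hes _ (hx s)]), zero_smul]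
    exact zero_mem _
  · push Not at h
    refine Submodule.smul_mem _ _ (Submodule.subset_span
      ⟨fun t => (f.symm t).elim 0 e, _, fun t => ?_, ?_, rfl⟩)
    · rcases ht : f.symm t with _ | r
      · simpa [ht] using hu
      · simpa [ht] using hx r
    · rw [← he]
      symm
      refine Finset.sum_bij_ne_zero (fun s _ hs => (f s).get
        (Option.isSome_iff_ne_none.2 fun h0 => hs (h s h0))) (fun _ _ _ => Finset.mem_univ _)
        ?_ ?_ ?_
      · intro a _ ha b _ hb hab
        exact f.inj (Option.get_mem _) (hab.symm ▸ Option.get_mem _)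
      · intro t _ ht
        rcases hs : f.symm t with _ | r
        · simp [hs] at ht
        · refine ⟨r, Finset.mem_univ _, by simpa [hs] using ht, ?_⟩
          simp [f.eq_some_iff.1 hs]
      · intro s _ hs
        have h2 : f s = some ((f s).get
          (Option.isSome_iff_ne_none.2 fun h0 => hs (h s h0))) := by simp
        rw [f.eq_some_iff.2 h2]
        rfl

variable (𝒱 : ℕ → Submodule k W) (e : 𝒱 0 ≃ₗ[k] k)

/-- The element `1` of `k = 𝒱 0`, seen in `W`. -/
def unit0 : W := (e.symm 1 : 𝒱 0)

lemma unit0_mem : unit0 𝒱 e ∈ 𝒱 0 := (e.symm 1).2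

variable [DirectSum.Decomposition 𝒱]

/-- The projection of a graded vector space `W` onto its degree `0` part `𝒱 0 = k`. -/
def proj0 : W →ₗ[k] k :=
  e.toLinearMap ∘ₗ DirectSum.component k ℕ (fun n => 𝒱 n) 0 ∘ₗ
    (DirectSum.decomposeLinearEquiv 𝒱).toLinearMap

lemma proj0_unit0 : proj0 𝒱 e (unit0 𝒱 e) = 1 := by
  change e (DirectSum.decompose 𝒱 ((e.symm 1 : 𝒱 0) : W) 0) = 1
  rw [DirectSum.decompose_coe, DirectSum.of_eq_same, e.apply_symm_apply]

lemma proj0_degree : ∀ n ≠ 0, ∀ x ∈ 𝒱 n, proj0 𝒱 e x = 0 := by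
  intro n hn x hx
  have h : (DirectSum.decompose 𝒱 x) 0 = 0 :=
    Subtype.ext (DirectSum.decompose_of_mem_ne 𝒱 hx hn)
  change e (DirectSum.decompose 𝒱 x 0) = 0
  rw [h, map_zero]

/-- The action of a morphism of `FI♯^m` on `⨂ i, W^{⊗ d i}`. -/
def tensorPowerMap {m : ℕ} {c d : FISharpm m} (f : c ⟶ d) :
    (⨂[k] i : Fin m, ⨂[k] _ : c i, W) →ₗ[k] (⨂[k] i : Fin m, ⨂[k] _ : d i, W) :=
  PiTensorProduct.map fun i => sharpMap (proj0 𝒱 e) (unit0 𝒱 e) (f i)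

lemma tensorPowerMap_id {m : ℕ} (d : FISharpm m) :
    tensorPowerMap 𝒱 e (𝟙 d) = LinearMap.id := by
  have h : (fun i => sharpMap (proj0 𝒱 e) (unit0 𝒱 e) ((𝟙 d : d ⟶ d) i)) =
      fun i : Fin m => (LinearMap.id : (⨂[k] _ : d i, W) →ₗ[k] _) :=
    funext fun i => sharpMap_refl _ _
  exact (congrArg PiTensorProduct.map h).trans PiTensorProduct.map_id

lemma tensorPowerMap_comp {m : ℕ} {b c d : FISharpm m} (f : b ⟶ c) (g : c ⟶ d) :
    tensorPowerMap 𝒱 e (f ≫ g) = tensorPowerMap 𝒱 e g ∘ₗ tensorPowerMap 𝒱 e f := by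
  have h : (fun i => sharpMap (proj0 𝒱 e) (unit0 𝒱 e) ((f ≫ g) i)) =
      fun i => sharpMap (proj0 𝒱 e) (unit0 𝒱 e) (g i) ∘ₗ sharpMap (proj0 𝒱 e) (unit0 𝒱 e) (f i) :=
    funext fun i => sharpMap_trans _ _ (proj0_unit0 𝒱 e) (f i) (g i)
  exact (congrArg PiTensorProduct.map h).trans (PiTensorProduct.map_comp _ _)

/-- The graded `FI♯^m`-module `W^{⊗•}`, where `W^{⊗•} d` is the external tensor product of the
`W^{⊗ d i}`, for a graded vector space `W` with degree `0` part `𝒱 0 = k` (identified with `k` by `e`). -/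
def tensorPowers (m : ℕ) : FISharpm m ⥤ GradedObject ℕ (ModuleCat.{max w u} k) where
  obj d := fun n => ModuleCat.of k
    (tensorDegree (k := k) (M := fun i : Fin m => ⨂[k] _ : d i, W)
      (fun i => tensorDegree fun _ : d i => 𝒱) n)
  map {c d} f := fun n => ModuleCat.ofHom ((tensorPowerMap 𝒱 e f).restrict
    (tensorDegree_map _ _ _ (fun i j => sharpMap_degree _ _ _ (unit0_mem 𝒱 e)
      (proj0_degree 𝒱 e) (f i) j) n))
  map_id d := by
    funext n
    ext x
    change tensorPowerMap 𝒱 e (𝟙 d) x.1 = x.1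
    rw [tensorPowerMap_id]
    rfl
  map_comp f g := by
    funext n
    ext x
    change tensorPowerMap 𝒱 e (f ≫ g) x.1 = tensorPowerMap 𝒱 e g (tensorPowerMap 𝒱 e f x.1)
    rw [tensorPowerMap_comp]
    rfl

end TensorPowers

/-! ### The cohomology algebra of a simplicial set and of a space -/

section Cohomology

variable (k : Type u) [Field k]

/-- `n`-cochains of a simplicial set with coefficients in `k`. -/
abbrev Cochain (K : SSet.{w}) (n : ℕ) : Type (max u w) := K.obj (op (.mk n)) → k

/-- The coboundary `(dφ)(σ) = ∑ i, (-1)^i φ(∂_i σ)`. -/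
def coboundary (K : SSet.{w}) (n : ℕ) : Cochain k K n →ₗ[k] Cochain k K (n + 1) where
  toFun φ := fun σ => ∑ i : Fin (n + 2), (-1) ^ (i : ℕ) * φ (K.δ i σ)
  map_add' φ ψ := by
    funext σ
    simp [mul_add, Finset.sum_add_distrib]
  map_smul' c φ := by
    funext σ
    simp [Finset.mul_sum, mul_left_comm]

/-- The inclusion of the front face `{0, …, p}` of `{0, …, n}`. -/
def front {p n : ℕ} (h : p ≤ n) : SimplexCategory.mk p ⟶ SimplexCategory.mk n :=
  SimplexCategory.mkHom (Fin.castLEOrderEmb (Nat.succ_le_succ h)).toOrderHom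

/-- The inclusion of the back face `{p, …, p + q}` of `{0, …, n}`, where `p + q = n`. -/
def back {p q n : ℕ} (h : p + q = n) : SimplexCategory.mk q ⟶ SimplexCategory.mk n :=
  SimplexCategory.mkHom
    { toFun := fun j => ⟨p + j, by omega⟩
      monotone' := fun i j hij => by
        have : (i : ℕ) ≤ j := hij
        exact Fin.mk_le_mk.2 (by omega) }

/-- The cup product `(φ ∪ ψ)(σ) = φ(front p-face of σ) ψ(back q-face of σ)` of cochains. -/
def cup (K : SSet.{w}) {p q n : ℕ} (h : p + q = n) :
    Cochain k K p →ₗ[k] Cochain k K q →ₗ[k] Cochain k K n :=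
  LinearMap.mk₂ k
    (fun φ ψ σ => φ (K.map (front (Nat.le.intro h)).op σ) * ψ (K.map (back h).op σ))
    (fun _ _ _ => funext fun _ => add_mul _ _ _)
    (fun _ _ _ => funext fun _ => mul_assoc _ _ _)
    (fun _ _ _ => funext fun _ => mul_add _ _ _)
    (fun _ _ _ => funext fun _ => mul_left_comm _ _ _)

/-- The constant cochain `1`. -/
def oneCochain (K : SSet.{w}) : Cochain k K 0 := fun _ => 1

variable {k}

/-- The ordinal map underlying the `i`-th face map. -/
def faceMap (n i : ℕ) : SimplexCategory.mk n ⟶ SimplexCategory.mk (n + 1) :=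
  SimplexCategory.mkHom
    { toFun := fun j => ⟨if (j : ℕ) < i then j else j + 1, by split <;> omega⟩
      monotone' := fun a b hab => by
        have : (a : ℕ) ≤ b := hab
        refine Fin.mk_le_mk.2 ?_
        split <;> split <;> omega }

lemma hom_ext_val {p n : ℕ} {f g : SimplexCategory.mk p ⟶ SimplexCategory.mk n}
    (h : ∀ j : Fin (p + 1), (f.toOrderHom j : ℕ) = g.toOrderHom j) : f = g :=
  SimplexCategory.Hom.ext _ _ (OrderHom.ext _ _ (funext fun j => Fin.ext (h j)))

lemma faceMap_eq {n : ℕ} (i : Fin (n + 2)) : SimplexCategory.δ i = faceMap n i := by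
  refine hom_ext_val fun j => ?_
  change ((Fin.succAbove i j : Fin _) : ℕ) = if (j : ℕ) < i then (j : ℕ) else j + 1
  rw [Fin.succAbove]
  simp only [Fin.lt_def, Fin.val_castSucc]
  split <;> rfl

lemma coboundary_apply {K : SSet.{w}} {n : ℕ} (φ : Cochain k K n) (σ : K.obj (op (.mk (n + 1)))) :
    coboundary k K n φ σ =
      ∑ i ∈ Finset.range (n + 2), (-1) ^ i * φ (K.map (faceMap n i).op σ) := by
  rw [Finset.sum_range fun i => (-1 : k) ^ i * φ (K.map (faceMap n i).op σ)]
  have h : ∀ i : Fin (n + 2), (-1 : k) ^ (i : ℕ) * φ (K.δ i σ) =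
      (-1) ^ (i : ℕ) * φ (K.map (faceMap n i).op σ) := fun i => by
    rw [← faceMap_eq]
    rfl
  exact Fintype.sum_congr _ _ h

lemma cup_apply {K : SSet.{w}} {p q n : ℕ} (h : p + q = n) (φ : Cochain k K p)
    (ψ : Cochain k K q) (σ : K.obj (op (.mk n))) :
    cup k K h φ ψ σ = φ (K.map (front (Nat.le.intro h)).op σ) * ψ (K.map (back h).op σ) := rfl

lemma map_map {K : SSet.{w}} {a b c : ℕ} (f : SimplexCategory.mk a ⟶ SimplexCategory.mk b) (g : SimplexCategory.mk b ⟶ SimplexCategory.mk c) (σ : K.obj (op (.mk c))) :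
    K.map f.op (K.map g.op σ) = K.map (f ≫ g).op σ := by
  rw [op_comp, Functor.map_comp_apply]

lemma cup_assoc {K : SSet.{w}} {p q r pq qr n : ℕ} (h1 : p + q = pq) (h2 : pq + r = n)
    (h3 : q + r = qr) (h4 : p + qr = n) (φ : Cochain k K p) (ψ : Cochain k K q)
    (χ : Cochain k K r) :
    cup k K h2 (cup k K h1 φ ψ) χ = cup k K h4 φ (cup k K h3 ψ χ) := by
  subst h1 h2 h3
  funext σ
  have e1 : front (Nat.le.intro rfl : p ≤ p + q) ≫ front (Nat.le.intro rfl : p + q ≤ p + q + r) =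
      front (Nat.le.intro h4) := hom_ext_val fun j => rfl
  have e2 : back (rfl : p + q = p + q) ≫ front (Nat.le.intro rfl : p + q ≤ p + q + r) =
      front (Nat.le.intro rfl : q ≤ q + r) ≫ back h4 := hom_ext_val fun j => rfl
  have e3 : back (rfl : p + q + r = p + q + r) = back (rfl : q + r = q + r) ≫ back h4 :=
    hom_ext_val fun j => Nat.add_assoc p q j
  simp only [cup_apply, map_map, mul_assoc, e1, e2, e3]

lemma one_cup {K : SSet.{w}} {n : ℕ} (h : 0 + n = n) (φ : Cochain k K n) :
    cup k K h (oneCochain k K) φ = φ := by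
  funext σ
  rw [cup_apply, oneCochain, one_mul]
  have : back h = 𝟙 (SimplexCategory.mk n) := hom_ext_val fun j => Nat.zero_add _
  rw [this, op_id, Functor.map_id_apply]

lemma cup_one {K : SSet.{w}} {n : ℕ} (h : n + 0 = n) (φ : Cochain k K n) :
    cup k K h φ (oneCochain k K) = φ := by
  funext σ
  rw [cup_apply, oneCochain, mul_one]
  have : front (Nat.le.intro h) = 𝟙 (SimplexCategory.mk n) := hom_ext_val fun j => rfl
  rw [this, op_id, Functor.map_id_apply]

lemma coboundary_one (K : SSet.{w}) : coboundary k K 0 (oneCochain k K) = 0 := by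
  funext σ
  simp [coboundary_apply, oneCochain, Finset.sum_range_succ]

lemma coboundary_cup {K : SSet.{w}} {p q n : ℕ} (h : p + q = n) (φ : Cochain k K p)
    (ψ : Cochain k K q) :
    coboundary k K n (cup k K h φ ψ) =
      cup k K (by omega) (coboundary k K p φ) ψ +
        (-1 : k) ^ p • cup k K (by omega) φ (coboundary k K q ψ) := by
  subst h
  funext σ
  simp only [Pi.add_apply, Pi.smul_apply, cup_apply, coboundary_apply, map_map, smul_eq_mul]
  have hp : p + 1 + q = p + q + 1 := by omega
  have hq : p + (q + 1) = p + q + 1 := by omega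
  have e1 : ∀ i < p + 1, front (Nat.le.intro rfl : p ≤ p + q) ≫ faceMap (p + q) i =
      faceMap p i ≫ front (Nat.le.intro hp) := fun i _ => hom_ext_val fun j => rfl
  have e2 : ∀ i < p + 1, back (rfl : p + q = p + q) ≫ faceMap (p + q) i = back hp := by
    intro i hi
    refine hom_ext_val fun j => ?_
    change (if p + (j : ℕ) < i then p + (j : ℕ) else p + j + 1) = p + 1 + j
    split <;> omega
  have e3 : ∀ i, front (Nat.le.intro rfl : p ≤ p + q) ≫ faceMap (p + q) (p + 1 + i) =
      front (Nat.le.intro hq) := by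
    intro i
    refine hom_ext_val fun j => ?_
    have hj := j.2
    change (if (j : ℕ) < p + 1 + i then (j : ℕ) else j + 1) = j
    split <;> omega
  have e4 : ∀ i, back (rfl : p + q = p + q) ≫ faceMap (p + q) (p + 1 + i) =
      faceMap q (i + 1) ≫ back hq := by
    intro i
    refine hom_ext_val fun j => ?_
    change (if p + (j : ℕ) < p + 1 + i then p + (j : ℕ) else p + j + 1) =
      p + (if (j : ℕ) < i + 1 then (j : ℕ) else j + 1)
    split <;> split <;> omega
  have e5 : faceMap p (p + 1) ≫ front (Nat.le.intro hp) = front (Nat.le.intro hq) := by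
    refine hom_ext_val fun j => ?_
    have hj := j.2
    change (if (j : ℕ) < p + 1 then (j : ℕ) else j + 1) = j
    split <;> omega
  have e6 : faceMap q 0 ≫ back hq = back hp := by
    refine hom_ext_val fun j => ?_
    change p + (if (j : ℕ) < 0 then (j : ℕ) else j + 1) = p + 1 + j
    split <;> omega
  rw [show p + q + 2 = (p + 1) + (q + 1) by omega, Finset.sum_range_add,
    Finset.sum_range_succ _ (p + 1), Finset.sum_range_succ' _ (q + 1), add_mul, mul_add, mul_add,
    Finset.sum_mul, Finset.mul_sum, Finset.mul_sum, e5, e6]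
  have s1 : ∀ i ∈ Finset.range (p + 1),
      (-1 : k) ^ i * (φ (K.map (front (Nat.le.intro rfl) ≫ faceMap (p + q) i).op σ) *
        ψ (K.map (back rfl ≫ faceMap (p + q) i).op σ)) =
      (-1) ^ i * φ (K.map (faceMap p i ≫ front (Nat.le.intro hp)).op σ) *
        ψ (K.map (back hp).op σ) := by
    intro i hi
    rw [e1 i (Finset.mem_range.1 hi), e2 i (Finset.mem_range.1 hi), mul_assoc]
  have s2 : ∀ i ∈ Finset.range (q + 1),
      (-1 : k) ^ (p + 1 + i) *
        (φ (K.map (front (Nat.le.intro rfl) ≫ faceMap (p + q) (p + 1 + i)).op σ) *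
        ψ (K.map (back rfl ≫ faceMap (p + q) (p + 1 + i)).op σ)) =
      (-1) ^ p * (φ (K.map (front (Nat.le.intro hq)).op σ) *
        ((-1) ^ (i + 1) * ψ (K.map (faceMap q (i + 1) ≫ back hq).op σ))) := by
    intro i _
    rw [e3, e4]
    ring
  rw [Finset.sum_congr rfl s1, Finset.sum_congr rfl s2]
  ring

/-- The cocycles. -/
abbrev cocycles (k : Type u) [Field k] (K : SSet.{w}) (n : ℕ) : Submodule k (Cochain k K n) :=
  LinearMap.ker (coboundary k K n)

/-- The coboundaries. -/
def coboundaries (k : Type u) [Field k] (K : SSet.{w}) : ∀ n, Submodule k (Cochain k K n)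
  | 0 => ⊥
  | n + 1 => LinearMap.range (coboundary k K n)

/-- The `n`-th cohomology: cocycles modulo coboundaries. -/
def Coh (k : Type u) [Field k] (K : SSet.{w}) (n : ℕ) : Type (max u w) :=
  cocycles k K n ⧸ (coboundaries k K n).comap (cocycles k K n).subtype

instance (K : SSet.{w}) (n : ℕ) : AddCommGroup (Coh k K n) :=
  inferInstanceAs (AddCommGroup
    (cocycles k K n ⧸ (coboundaries k K n).comap (cocycles k K n).subtype))

instance (K : SSet.{w}) (n : ℕ) : Module k (Coh k K n) :=
  inferInstanceAs (Module k
    (cocycles k K n ⧸ (coboundaries k K n).comap (cocycles k K n).subtype))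

/-- The class of a cocycle. -/
def cohQ (k : Type u) [Field k] (K : SSet.{w}) (n : ℕ) : cocycles k K n →ₗ[k] Coh k K n :=
  Submodule.mkQ _

lemma cup_mem_cocycles {K : SSet.{w}} {p q n : ℕ} (h : p + q = n) {φ : Cochain k K p}
    {ψ : Cochain k K q} (hφ : φ ∈ cocycles k K p) (hψ : ψ ∈ cocycles k K q) :
    cup k K h φ ψ ∈ cocycles k K n := by
  rw [LinearMap.mem_ker] at *
  rw [coboundary_cup, hφ, hψ]
  simp

lemma cup_mem_left {K : SSet.{w}} {p q n : ℕ} (h : p + q = n) {φ : Cochain k K p}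
    {ψ : Cochain k K q} (hφ : φ ∈ coboundaries k K p) (hψ : ψ ∈ cocycles k K q) :
    cup k K h φ ψ ∈ coboundaries k K n := by
  cases p with
  | zero =>
    rw [(Submodule.mem_bot k).1 hφ]
    simp
  | succ p =>
    obtain ⟨α, rfl⟩ := hφ
    obtain rfl : n = p + q + 1 := by omega
    refine ⟨cup k K rfl α ψ, ?_⟩
    rw [coboundary_cup, LinearMap.mem_ker.1 hψ]
    simp

lemma cup_mem_right {K : SSet.{w}} {p q n : ℕ} (h : p + q = n) {φ : Cochain k K p}
    {ψ : Cochain k K q} (hφ : φ ∈ cocycles k K p) (hψ : ψ ∈ coboundaries k K q) :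
    cup k K h φ ψ ∈ coboundaries k K n := by
  cases q with
  | zero =>
    rw [(Submodule.mem_bot k).1 hψ]
    simp
  | succ q =>
    obtain ⟨α, rfl⟩ := hψ
    obtain rfl : n = p + q + 1 := by omega
    refine ⟨(-1 : k) ^ p • cup k K rfl φ α, ?_⟩
    rw [map_smul, coboundary_cup, LinearMap.mem_ker.1 hφ]
    simp [smul_smul, ← pow_add]

/-- The cup product of cocycles, as a cohomology class. -/
def cupCocycles (K : SSet.{w}) {p q n : ℕ} (h : p + q = n) :
    cocycles k K p →ₗ[k] cocycles k K q →ₗ[k] Coh k K n :=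
  LinearMap.mk₂ k
    (fun φ ψ => cohQ k K n ⟨cup k K h φ.1 ψ.1, cup_mem_cocycles h φ.2 ψ.2⟩)
    (fun _ _ _ => by
      rw [← map_add]; congr 1; ext1; simp)
    (fun _ _ _ => by
      rw [← map_smul]; congr 1; ext1; simp)
    (fun _ _ _ => by
      rw [← map_add]; congr 1; ext1; simp)
    (fun _ _ _ => by
      rw [← map_smul]; congr 1; ext1; simp)

/-- The cup product of cohomology classes. -/
def cohMul (k : Type u) [Field k] (K : SSet.{w}) {p q n : ℕ} (h : p + q = n) :
    Coh k K p →ₗ[k] Coh k K q →ₗ[k] Coh k K n :=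
  Submodule.liftQ _
    (LinearMap.flip (Submodule.liftQ _ (LinearMap.flip (cupCocycles K h)) (by
      intro ψ hψ
      rw [LinearMap.mem_ker]
      ext1 φ
      exact (Submodule.Quotient.mk_eq_zero _).2 (cup_mem_right h φ.2 hψ)))) (by
    intro φ hφ
    rw [LinearMap.mem_ker]
    refine LinearMap.ext fun y => Submodule.Quotient.induction_on _ y fun ψ => ?_
    exact (Submodule.Quotient.mk_eq_zero _).2 (cup_mem_left h hφ ψ.2))

/-- The class of a cocycle. -/
abbrev cohMk {K : SSet.{w}} {n : ℕ} (φ : Cochain k K n) (hφ : φ ∈ cocycles k K n) : Coh k K n :=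
  cohQ k K n ⟨φ, hφ⟩

lemma cohMul_mk {K : SSet.{w}} {p q n : ℕ} (h : p + q = n) (φ : Cochain k K p)
    (hφ : φ ∈ cocycles k K p) (ψ : Cochain k K q) (hψ : ψ ∈ cocycles k K q) :
    cohMul k K h (cohMk φ hφ) (cohMk ψ hψ) = cohMk (cup k K h φ ψ) (cup_mem_cocycles h hφ hψ) :=
  rfl

lemma coh_ind {K : SSet.{w}} {n : ℕ} {P : Coh k K n → Prop}
    (h : ∀ φ hφ, P (cohMk φ hφ)) (x : Coh k K n) : P x :=
  Submodule.Quotient.induction_on _ x fun ψ => h ψ.1 ψ.2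

/-- The unit of the cohomology algebra. -/
def cohOne (k : Type u) [Field k] (K : SSet.{w}) : Coh k K 0 :=
  cohMk (oneCochain k K) (LinearMap.mem_ker.2 (coboundary_one K))

lemma cohMul_assoc {K : SSet.{w}} {p q r pq qr n : ℕ} (h1 : p + q = pq) (h2 : pq + r = n)
    (h3 : q + r = qr) (h4 : p + qr = n) (x : Coh k K p) (y : Coh k K q) (z : Coh k K r) :
    cohMul k K h2 (cohMul k K h1 x y) z = cohMul k K h4 x (cohMul k K h3 y z) := by
  induction x using coh_ind with | _ φ hφ
  induction y using coh_ind with | _ ψ hψ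
  induction z using coh_ind with | _ χ hχ
  simp only [cohMul_mk, cup_assoc h1 h2 h3 h4]

lemma cohOne_mul {K : SSet.{w}} {n : ℕ} (h : 0 + n = n) (x : Coh k K n) :
    cohMul k K h (cohOne k K) x = x := by
  induction x using coh_ind with | _ φ hφ
  simp only [cohOne, cohMul_mk, one_cup]

lemma cohMul_one {K : SSet.{w}} {n : ℕ} (h : n + 0 = n) (x : Coh k K n) :
    cohMul k K h x (cohOne k K) = x := by
  induction x using coh_ind with | _ φ hφ
  simp only [cohOne, cohMul_mk, cup_one]

lemma mk_cohMul {K : SSet.{w}} {p q n : ℕ} (h : p + q = n) (x : Coh k K p) (y : Coh k K q) :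
    (GradedMonoid.mk (p + q) (cohMul k K rfl x y) : GradedMonoid (Coh k K)) =
      GradedMonoid.mk n (cohMul k K h x y) := by
  subst h
  rfl

instance (K : SSet.{w}) : GradedMonoid.GOne (Coh k K) where
  one := cohOne k K

instance (K : SSet.{w}) : GradedMonoid.GMul (Coh k K) where
  mul x y := cohMul k K rfl x y

instance (K : SSet.{w}) : DirectSum.GRing (Coh k K) where
  one_mul := fun ⟨n, x⟩ => by
    change GradedMonoid.mk (0 + n) (cohMul k K rfl (cohOne k K) x) = GradedMonoid.mk n x
    rw [mk_cohMul (zero_add n), cohOne_mul]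
  mul_one := fun ⟨n, x⟩ => by
    change GradedMonoid.mk (n + 0) (cohMul k K rfl x (cohOne k K)) = GradedMonoid.mk n x
    rw [mk_cohMul (add_zero n), cohMul_one]
  mul_assoc := fun ⟨p, x⟩ ⟨q, y⟩ ⟨r, z⟩ => by
    change GradedMonoid.mk (p + q + r) (cohMul k K rfl (cohMul k K rfl x y) z) =
      GradedMonoid.mk (p + (q + r)) (cohMul k K rfl x (cohMul k K rfl y z))
    rw [mk_cohMul (add_assoc p q r), cohMul_assoc]
  mul_zero x := map_zero _
  zero_mul y := by
    change cohMul k K rfl 0 y = 0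
    simp
  mul_add x y z := map_add _ _ _
  add_mul x y z := by
    change cohMul k K rfl (x + y) z = _
    rw [map_add]
    rfl
  natCast n := n • cohOne k K
  natCast_zero := zero_smul _ _
  natCast_succ n := succ_nsmul _ n
  intCast n := n • cohOne k K
  intCast_ofNat n := natCast_zsmul _ _
  intCast_negSucc_ofNat n := negSucc_zsmul _ _

instance (K : SSet.{w}) : DirectSum.GAlgebra k (Coh k K) where
  toFun := (LinearMap.toSpanSingleton k (Coh k K 0) (cohOne k K)).toAddMonoidHom
  map_one := by
    change (1 : k) • cohOne k K = cohOne k K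
    rw [one_smul]
  map_mul r s := by
    change GradedMonoid.mk 0 ((r * s) • cohOne k K) =
      GradedMonoid.mk (0 + 0) (cohMul k K rfl (r • cohOne k K) (s • cohOne k K))
    rw [mk_cohMul (add_zero 0), map_smul, map_smul, LinearMap.smul_apply, cohOne_mul, smul_smul,
      mul_comm]
  commutes r := fun ⟨n, x⟩ => by
    change GradedMonoid.mk (0 + n) (cohMul k K rfl (r • cohOne k K) x) =
      GradedMonoid.mk (n + 0) (cohMul k K rfl x (r • cohOne k K))
    rw [mk_cohMul (zero_add n), mk_cohMul (add_zero n), map_smul, map_smul, LinearMap.smul_apply,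
      cohOne_mul, cohMul_one]
  smul_def r := fun ⟨n, x⟩ => by
    change GradedMonoid.mk n (r • x) =
      GradedMonoid.mk (0 + n) (cohMul k K rfl (r • cohOne k K) x)
    rw [mk_cohMul (zero_add n), map_smul, LinearMap.smul_apply, cohOne_mul]

/-- The degree `n` part of the algebra `⨁ n, H^n`. -/
def cohDegree (k : Type u) [Field k] (K : SSet.{w}) (n : ℕ) : Submodule k (⨁ n, Coh k K n) :=
  LinearMap.range (DirectSum.lof k ℕ (Coh k K) n)

instance (K : SSet.{w}) : SetLike.GradedMonoid (cohDegree k K) where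
  one_mem := ⟨cohOne k K, rfl⟩
  mul_mem := by
    rintro p q _ _ ⟨x, rfl⟩ ⟨y, rfl⟩
    exact ⟨cohMul k K rfl x y, (DirectSum.of_mul_of x y).symm⟩

instance (K : SSet.{w}) : DirectSum.Decomposition (cohDegree k K) :=
  DirectSum.Decomposition.ofLinearMap (cohDegree k K)
    (DirectSum.toModule k ℕ _ fun n => DirectSum.lof k ℕ (fun n => cohDegree k K n) n ∘ₗ
      (DirectSum.lof k ℕ (Coh k K) n).codRestrict (cohDegree k K n) fun x => ⟨x, rfl⟩)
    (by
      refine DirectSum.linearMap_ext _ fun n => LinearMap.ext fun x => ?_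
      simp only [LinearMap.comp_apply, DirectSum.toModule_lof]
      rw [DirectSum.lof_eq_of, DirectSum.lof_eq_of, DirectSum.coeLinearMap_of]
      rfl)
    (by
      refine DirectSum.linearMap_ext _ fun n => LinearMap.ext fun y => ?_
      obtain ⟨_, x, rfl⟩ := y
      simp only [LinearMap.comp_apply]
      rw [DirectSum.lof_eq_of, DirectSum.coeLinearMap_of, DirectSum.toModule_lof]
      rfl)

instance (K : SSet.{w}) : GradedAlgebra (cohDegree k K) where

/-- The cohomology algebra `H^*(K; k)` of a simplicial set, with the cup product. -/
def cohAlg (k : Type u) [Field k] (K : SSet.{w}) : GrAlg.{u, max u w} k where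
  carrier := ⨁ n, Coh k K n
  grading := cohDegree k K

/-- Pullback of cochains. -/
def cochainMap {K L : SSet.{w}} (f : K ⟶ L) (n : ℕ) : Cochain k L n →ₗ[k] Cochain k K n :=
  LinearMap.funLeft k k (f.app (op (.mk n)))

lemma cochainMap_map {K L : SSet.{w}} (f : K ⟶ L) {m n : ℕ}
    (g : SimplexCategory.mk m ⟶ SimplexCategory.mk n) (φ : Cochain k L m)
    (σ : K.obj (op (.mk n))) :
    cochainMap f m φ (K.map g.op σ) = φ (L.map g.op (f.app (op (.mk n)) σ)) :=
  congrArg φ (NatTrans.naturality_apply f g.op σ)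

lemma cochainMap_coboundary {K L : SSet.{w}} (f : K ⟶ L) (n : ℕ) (φ : Cochain k L n) :
    cochainMap f (n + 1) (coboundary k L n φ) = coboundary k K n (cochainMap f n φ) := by
  funext σ
  rw [coboundary_apply]
  simp only [cochainMap_map]
  exact coboundary_apply _ _

lemma cochainMap_cup {K L : SSet.{w}} (f : K ⟶ L) {p q n : ℕ} (h : p + q = n)
    (φ : Cochain k L p) (ψ : Cochain k L q) :
    cochainMap f n (cup k L h φ ψ) = cup k K h (cochainMap f p φ) (cochainMap f q ψ) := by
  funext σ
  rw [cup_apply]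
  simp only [cochainMap_map]
  exact cup_apply _ _ _ _

lemma cochainMap_cocycles {K L : SSet.{w}} (f : K ⟶ L) (n : ℕ) :
    ∀ φ ∈ cocycles k L n, cochainMap f n φ ∈ cocycles k K n := by
  intro φ hφ
  rw [LinearMap.mem_ker] at *
  rw [← cochainMap_coboundary, hφ, map_zero]

lemma cochainMap_coboundaries {K L : SSet.{w}} (f : K ⟶ L) (n : ℕ) :
    ∀ φ ∈ coboundaries k L n, cochainMap f n φ ∈ coboundaries k K n := by
  intro φ hφ
  cases n with
  | zero =>
    rw [(Submodule.mem_bot k).1 hφ, map_zero]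
    exact zero_mem _
  | succ n =>
    obtain ⟨α, rfl⟩ := hφ
    exact ⟨cochainMap f n α, (cochainMap_coboundary f n α).symm⟩

/-- Pullback of cohomology classes. -/
def cohMap (k : Type u) [Field k] {K L : SSet.{w}} (f : K ⟶ L) (n : ℕ) :
    Coh k L n →ₗ[k] Coh k K n :=
  Submodule.mapQ _ _ ((cochainMap f n).restrict (cochainMap_cocycles f n))
    fun φ hφ => cochainMap_coboundaries f n φ.1 hφ

lemma cohMap_mk {K L : SSet.{w}} (f : K ⟶ L) (n : ℕ) (φ : Cochain k L n)
    (hφ : φ ∈ cocycles k L n) :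
    cohMap k f n (cohMk φ hφ) = cohMk (cochainMap f n φ) (cochainMap_cocycles f n φ hφ) := rfl

lemma cohMap_mul {K L : SSet.{w}} (f : K ⟶ L) {p q n : ℕ} (h : p + q = n) (x : Coh k L p)
    (y : Coh k L q) :
    cohMap k f n (cohMul k L h x y) = cohMul k K h (cohMap k f p x) (cohMap k f q y) := by
  induction x using coh_ind with | _ φ hφ
  induction y using coh_ind with | _ ψ hψ
  simp only [cohMul_mk, cohMap_mk, cochainMap_cup]

/-- The map of cohomology algebras induced by a map of simplicial sets. -/
def cohAlgMap (k : Type u) [Field k] {K L : SSet.{w}} (f : K ⟶ L) :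
    cohDegree k L →ₐᵍ[k] cohDegree k K where
  __ := DirectSum.toAlgebra k (Coh k L)
    (fun n => DirectSum.lof k ℕ (Coh k K) n ∘ₗ cohMap k f n) rfl (fun {p q} x y => by
      change DirectSum.of (Coh k K) _ (cohMap k f _ (cohMul k L rfl x y)) =
        DirectSum.of (Coh k K) _ (cohMap k f p x) * DirectSum.of (Coh k K) _ (cohMap k f q y)
      rw [DirectSum.of_mul_of, cohMap_mul]
      rfl)
  map_mem := by
    rintro n _ ⟨x, rfl⟩
    exact ⟨cohMap k f n x, Eq.symm (DirectSum.toModule_lof k (φ := fun n =>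
      DirectSum.lof k ℕ (Coh k K) n ∘ₗ cohMap k f n) n x)⟩

lemma cohAlgMap_lof {K L : SSet.{w}} (f : K ⟶ L) (n : ℕ) (x : Coh k L n) :
    cohAlgMap k f (DirectSum.lof k ℕ (Coh k L) n x) =
      DirectSum.lof k ℕ (Coh k K) n (cohMap k f n x) :=
  DirectSum.toModule_lof k n x

lemma cohAlg_hom_ext {K L : SSet.{w}} {f g : cohDegree k L →ₐᵍ[k] cohDegree k K}
    (h : ∀ n x, f (DirectSum.lof k ℕ (Coh k L) n x) = g (DirectSum.lof k ℕ (Coh k L) n x)) :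
    f = g := by
  refine DFunLike.ext _ _ fun y => ?_
  have h2 : f.toAlgHom.toLinearMap = g.toAlgHom.toLinearMap :=
    DirectSum.linearMap_ext _ fun n => LinearMap.ext fun x => h n x
  exact LinearMap.congr_fun h2 y

/-- The cohomology algebra, as a contravariant functor on simplicial sets. -/
def cohomology (k : Type u) [Field k] : SSet.{w}ᵒᵖ ⥤ GrAlg.{u, max u w} k where
  obj K := cohAlg k K.unop
  map f := cohAlgMap k f.unop
  map_id K := by
    refine cohAlg_hom_ext fun n x => ?_
    induction x using coh_ind with | _ φ hφ
    exact cohAlgMap_lof _ _ _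
  map_comp {K L M} f g := by
    refine cohAlg_hom_ext fun n x => ?_
    refine (cohAlgMap_lof _ _ _).trans ?_
    change _ = cohAlgMap k g.unop (cohAlgMap k f.unop (DirectSum.lof k ℕ (Coh k K.unop) n x))
    rw [cohAlgMap_lof, cohAlgMap_lof]
    induction x using coh_ind with | _ φ hφ
    rfl

/-- The singular cohomology algebra `H^*(X; k)`, as a contravariant functor on spaces. -/
def singularCohomology (k : Type u) [Field k] : TopCat.{w}ᵒᵖ ⥤ GrAlg.{u, max u w} k :=
  TopCat.toSSet.op ⋙ cohomology k

/-- The co-`FI♯^m`-space `X^•` of a space `X` with base point `x₀`, where `X^d = ∏ i, X^{d i}`.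
A morphism `f : c ⟶ d` sends `v ∈ X^d` to the point of `X^c` whose coordinate at `s` is the
coordinate of `v` at `f s` if `f` is defined at `s`, and is `x₀` otherwise. -/
def coSpace (X : Type w) [TopologicalSpace X] (x₀ : X) (m : ℕ) :
    (FISharpm m)ᵒᵖ ⥤ TopCat.{w} where
  obj d := TopCat.of (∀ i : Fin m, d.unop i → X)
  map {d c} f := TopCat.ofHom
    { toFun := fun v i s => (PEquiv.toFun (f.unop i) s).elim x₀ (v i)
      continuous_toFun := by
        refine continuous_pi fun i => continuous_pi fun s => ?_
        rcases PEquiv.toFun (f.unop i) s with _ | t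
        · exact continuous_const
        · exact (continuous_apply t).comp (continuous_apply i) }
  map_id d := rfl
  map_comp {d c b} f g := by
    refine TopCat.hom_ext (ContinuousMap.ext fun v => funext fun i => funext fun s => ?_)
    change (Option.bind (PEquiv.toFun (g.unop i) s) (PEquiv.toFun (f.unop i))).elim x₀ (v i) =
      (PEquiv.toFun (g.unop i) s).elim x₀ fun t => (PEquiv.toFun (f.unop i) t).elim x₀ (v i)
    rcases PEquiv.toFun (g.unop i) s with _ | t <;> rfl

/-- The functor `H^*(X^•; k)` from `FI♯^m` to graded algebras. -/
def cohomologyPowers (k : Type u) [Field k] (X : Type w) [TopologicalSpace X] (x₀ : X) (m : ℕ) :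
    FISharpm m ⥤ GrAlg.{u, max u w} k :=
  (coSpace X x₀ m).rightOp ⋙ singularCohomology k

end Cohomology

end FIRep

end

open FIRep

/-! By `finGen_iff`, finite generation means that finitely many elements have images spanning every
`V d`. Each finiteness claim thus amounts to bounding the objects from which spanning elements come.

Tensor products (`finGen_tensor`): `f x ⊗ f' x'` already lives on the union of the images of `f` and
`f'`, whose size is at most the sum of the sizes of the two sources. Generated algebras
(`finiteType_of_generatedBy`): since `V^0 = 0`, the degree `0` part is spanned by `1`, and the
degree `n + 1` part is the sum of the images of `V^{i+1} ⊗ A^{n-i}` for `i ≤ n`, so induction on the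
degree reduces to tensor products. Tensor powers (`finiteType_tensorPowers`): a homogeneous pure
tensor of degree `n` has at most `n` factors of positive degree, and the remaining factors can be
taken to be the unit.

Cohomology of powers needs only half of the Künneth theorem: the algebra `H^*(X^d)` is generated by
the classes of positive degree pulled back along the coordinate projections
(`adjoin_pullbacks_eq_top`). In each degree these classes come from a basis of the cohomology of `X`
placed on the one-point objects, so the result on generated algebras applies. Generation follows, by
induction on the number of factors, from surjectivity of the cross product (`span_cross_eq_top`).

For surjectivity, consider the double complex of functions on `K_{p+q+1} × L_q`. A prism homotopy
(`sub_inflate_deflate_mem`) retracts column `p` onto the functions from `K_p` to cochains of `L`. A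
cocycle of `K × L` becomes a total cocycle in column `0`. Its leading component is a sum of products
of cocycles plus a column boundary; subtracting the product part and a total coboundary moves the
rest one column to the right (`Zigzag.mem_crossSpan`). `totalize` carries everything back to
cochains of `K × L`, where the subtracted products are cross products.

Graded commutativity is Steenrod's argument: on cocycles, the coboundary of the cup-one product is
the difference of the two cup products, up to sign (`coboundary_cupOne`). -/

noncomputable section

namespace FIRep

/-! ### Finite generation of modules over a category -/

section FiniteGeneration

variable {k : Type u} [Field k] {C : Type v} [Category.{v'} C]

/-- The images in `V d` of a set of elements of `V`. -/
def orbit {V : C ⥤ ModuleCat.{w} k} (s : Set (Σ c, V.obj c)) (d : C) : Set (V.obj d) :=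
  {y | ∃ x ∈ s, ∃ f : x.1 ⟶ d, (V.map f).hom x.2 = y}

lemma map_span_orbit {V : C ⥤ ModuleCat.{w} k} (s : Set (Σ c, V.obj c)) {c d : C} (f : c ⟶ d)
    (x : V.obj c) (hx : x ∈ Submodule.span k (orbit s c)) :
    (V.map f).hom x ∈ Submodule.span k (orbit s d) := by
  change x ∈ (Submodule.span k (orbit s d)).comap (V.map f).hom
  revert x
  change Submodule.span k (orbit s c) ≤ _
  refine Submodule.span_le.2 ?_
  rintro _ ⟨x, hx, g, rfl⟩
  exact Submodule.subset_span ⟨x, hx, g ≫ f, by simp⟩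

/-- The submodule generated by a set of elements. -/
def orbitSpan {V : C ⥤ ModuleCat.{w} k} (s : Set (Σ c, V.obj c)) : SubMod V where
  carrier d := Submodule.span k (orbit s d)
  map_mem f x hx := map_span_orbit s f x hx

lemma subset_orbit {V : C ⥤ ModuleCat.{w} k} {s : Set (Σ c, V.obj c)} {x : Σ c, V.obj c}
    (hx : x ∈ s) : x.2 ∈ orbit s x.1 :=
  ⟨x, hx, 𝟙 _, by simp⟩

lemma mem_span_orbit {V : C ⥤ ModuleCat.{w} k} {s : Set (Σ c, V.obj c)} {x : Σ c, V.obj c}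
    (hx : x ∈ s) {d : C} (f : x.1 ⟶ d) {y : V.obj d} (h : (V.map f).hom x.2 = y) :
    y ∈ Submodule.span k (orbit s d) :=
  Submodule.subset_span ⟨x, hx, f, h⟩

/-- The orbit span is the smallest submodule containing `s`, so testing it alone replaces the
quantification over all submodules. -/
lemma finGen_iff {V : C ⥤ ModuleCat.{w} k} :
    FinGen V ↔ ∃ s : Set (Σ c, V.obj c), s.Finite ∧ ∀ d, Submodule.span k (orbit s d) = ⊤ := by
  constructor
  · rintro ⟨s, hs, h⟩
    exact ⟨s, hs, h (orbitSpan s) fun x hx => Submodule.subset_span (subset_orbit hx)⟩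
  · rintro ⟨s, hs, h⟩
    refine ⟨s, hs, fun N hN c => top_le_iff.1 ?_⟩
    rw [← h c, Submodule.span_le]
    rintro _ ⟨x, hx, f, rfl⟩
    exact N.map_mem f _ (hN x hx)

/-- Allows generators of a submodule to be given as elements of the ambient functor. The inclusion
is injective on pairs (object, element), so the preimage of `s` stays finite. -/
lemma finGen_toFunctor {V : C ⥤ ModuleCat.{w} k} (N : SubMod V) (s : Set (Σ c, V.obj c))
    (hs : s.Finite) (hN : ∀ x ∈ s, x.2 ∈ N.carrier x.1)
    (h : ∀ d, N.carrier d ≤ Submodule.span k (orbit s d)) : FinGen N.toFunctor := by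
  refine ⟨(fun x : Σ c, N.carrier c => (⟨x.1, x.2.1⟩ : Σ c, V.obj c)) ⁻¹' s,
    hs.preimage ?_, fun P hP c => top_le_iff.1 ?_⟩
  · rintro ⟨a, x⟩ - ⟨b, y⟩ - hxy
    obtain ⟨rfl, h2⟩ := Sigma.mk.inj hxy
    cases Subtype.ext (eq_of_heq h2)
    rfl
  · have key : Submodule.span k (orbit s c) ≤ (P.carrier c).map (N.carrier c).subtype := by
      rw [Submodule.span_le]
      rintro _ ⟨x, hx, f, rfl⟩
      exact ⟨_, P.map_mem f ⟨x.2, hN x hx⟩ (hP ⟨x.1, x.2, hN x hx⟩ hx), rfl⟩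
    rintro ⟨y, hy⟩ -
    obtain ⟨z, hz, rfl⟩ := key (h c hy)
    exact hz

/-- A submodule of `V'` containing the images of the generators pulls back along each `φ i` to all
of `V i`. This handles quotients of finite direct sums without forming the sum. -/
lemma finGen_of_iSup_range {ι : Type*} [Finite ι] {V' : C ⥤ ModuleCat.{w'} k}
    (V : ι → C ⥤ ModuleCat.{w} k) (hV : ∀ i, FinGen (V i))
    (φ : ∀ i c, (V i).obj c →ₗ[k] V'.obj c)
    (hφ : ∀ i {c d : C} (f : c ⟶ d) (x : (V i).obj c),
      φ i d (((V i).map f).hom x) = (V'.map f).hom (φ i c x))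
    (h : ∀ c, ⨆ i, LinearMap.range (φ i c) = ⊤) : FinGen V' := by
  choose s hs hsV using hV
  refine ⟨⋃ i, (fun x : Σ c, (V i).obj c => (⟨x.1, φ i x.1 x.2⟩ : Σ c, V'.obj c)) '' s i,
    Set.finite_iUnion fun i => (hs i).image _, fun N hN c => top_le_iff.1 ?_⟩
  rw [← h c, iSup_le_iff]
  rintro i _ ⟨x, rfl⟩
  have := hsV i ⟨fun d => (N.carrier d).comap (φ i d), fun {c d} f x hx => by
    rw [Submodule.mem_comap, hφ]
    exact N.map_mem f _ hx⟩ (fun x hx => hN _ (Set.mem_iUnion.2 ⟨i, x, hx, rfl⟩)) c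
  change x ∈ (N.carrier c).comap (φ i c)
  rw [show (N.carrier c).comap (φ i c) = ⊤ from this]
  trivial

end FiniteGeneration

/-! ### Tensor products of finitely generated `FI^m`-modules -/

section Tensor

/-- The object of `FI^m` with components `{0, …, a i - 1}`. -/
def stdObj {m : ℕ} (a : Fin m → ℕ) : FIm m := fun i => ⟨Fin (a i)⟩

instance FIm.finite_hom {m : ℕ} (c d : FIm m) : Finite (c ⟶ d) :=
  inferInstanceAs (Finite (∀ i, c i ↪ d i))

/-- The components of a morphism of `FI^m`. -/
def FIm.emb {m : ℕ} {c d : FIm m} (f : c ⟶ d) (i : Fin m) : c i ↪ d i := f i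

/-- A family of subsets of an object of `FI^m` is the image of a morphism. -/
lemma exists_stdObj_hom {m : ℕ} {d : FIm m} (T : ∀ i, Finset (d i)) :
    ∃ h : stdObj (fun i => (T i).card) ⟶ d, ∀ i x, x ∈ T i ↔ ∃ y, FIm.emb h i y = x := by
  refine ⟨fun i => ((T i).equivFin.symm.toEmbedding.trans (Function.Embedding.subtype _) :
    Fin (T i).card ↪ d i), fun i x => ⟨fun hx => ⟨(T i).equivFin ⟨x, hx⟩, ?_⟩, ?_⟩⟩
  · change (((T i).equivFin.symm ((T i).equivFin ⟨x, hx⟩) : T i) : d i) = x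
    simp
  · rintro ⟨y, rfl⟩
    exact ((T i).equivFin.symm y).2

lemma exists_factor {m : ℕ} {c e d : FIm m} (h : e ⟶ d) (f : c ⟶ d)
    (hf : ∀ i x, ∃ y, FIm.emb h i y = FIm.emb f i x) : ∃ f' : c ⟶ e, f' ≫ h = f := by
  choose g hg using hf
  refine ⟨fun i => (⟨g i, fun x y hxy => (FIm.emb f i).injective ?_⟩ : c i ↪ e i),
    funext fun i => Function.Embedding.ext fun x => hg i x⟩
  rw [← hg, ← hg, hxy]

variable {k : Type u} [Field k]

lemma eq_top_of_tmul_mem {M : Type*} {M' : Type*} [AddCommGroup M] [AddCommGroup M'] [Module k M]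
    [Module k M'] {A : Set M} {A' : Set M'} (hA : Submodule.span k A = ⊤)
    (hA' : Submodule.span k A' = ⊤) {N : Submodule k (M ⊗[k] M')}
    (h : ∀ a ∈ A, ∀ a' ∈ A', a ⊗ₜ a' ∈ N) : N = ⊤ := by
  rw [← top_le_iff, ← TensorProduct.map₂_mk_top_top_eq_top, ← hA, ← hA', Submodule.map₂_span_span,
    Submodule.span_le]
  rintro _ ⟨a, ha, a', ha', rfl⟩
  exact h a ha a' ha'

open Classical in
lemma finGen_tensor {m : ℕ} {V : FIm m ⥤ ModuleCat.{w} k} {V' : FIm m ⥤ ModuleCat.{w'} k}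
    (hV : FinGen V) (hV' : FinGen V') : FinGen (tensor V V') := by
  obtain ⟨s, hs, h⟩ := finGen_iff.1 hV
  obtain ⟨s', hs', h'⟩ := finGen_iff.1 hV'
  refine finGen_iff.2 ⟨⋃ x ∈ s, ⋃ x' ∈ s', ⋃ a ∈ Set.Iic fun i =>
    Fintype.card (x.1 i) + Fintype.card (x'.1 i),
    Set.range fun f : (x.1 ⟶ stdObj a) × (x'.1 ⟶ stdObj a) =>
      (⟨stdObj a, (V.map f.1).hom x.2 ⊗ₜ (V'.map f.2).hom x'.2⟩ : Σ c, (tensor V V').obj c),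
    hs.biUnion fun x _ => hs'.biUnion fun x' _ => (Set.finite_Iic _).biUnion fun a _ =>
      Set.finite_range _, fun d => eq_top_of_tmul_mem (h d) (h' d) ?_⟩
  rintro _ ⟨x, hx, f, rfl⟩ _ ⟨x', hx', f', rfl⟩
  -- The joint image of `f` and `f'`. Both factor through its inclusion `g`, and only finitely many
  -- standard objects and pairs `(f1, f2)` can occur.
  let T : ∀ i, Finset (d i) := fun i =>
    Finset.univ.image (FIm.emb f i) ∪ Finset.univ.image (FIm.emb f' i)
  obtain ⟨g, hg⟩ := exists_stdObj_hom T
  obtain ⟨f1, e1⟩ := exists_factor g f fun i x => (hg i _).1 (by simp [T])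
  obtain ⟨f2, e2⟩ := exists_factor g f' fun i x => (hg i _).1 (by simp [T])
  refine mem_span_orbit (V := tensor V V')
    (x := ⟨stdObj _, (V.map f1).hom x.2 ⊗ₜ (V'.map f2).hom x'.2⟩) ?_ g ?_
  · simp only [Set.mem_iUnion]
    refine ⟨x, hx, x', hx', _, fun i => ?_, ⟨f1, f2⟩, rfl⟩
    exact (Finset.card_union_le _ _).trans (Nat.add_le_add
      (Finset.card_image_le.trans le_rfl) (Finset.card_image_le.trans le_rfl))
  · have h1 : (V.map f).hom x.2 = (V.map g).hom ((V.map f1).hom x.2) :=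
      (congrArg (fun q => (V.map q).hom x.2) e1).symm.trans (by simp)
    have h2 : (V'.map f').hom x'.2 = (V'.map g).hom ((V'.map f2).hom x'.2) :=
      (congrArg (fun q => (V'.map q).hom x'.2) e2).symm.trans (by simp)
    change TensorProduct.map (V.map g).hom (V'.map g).hom _ = _ ⊗ₜ[k] _
    rw [h1, h2]
    exact TensorProduct.map_tmul _ _ _ _

end Tensor

/-! ### Graded algebras generated by a submodule of finite type -/

section GeneratedAlgebra

variable {k : Type u} [Field k]

section Algebra

variable {R : Type w} [Ring R] [Algebra k R] (𝒜 : ℕ → Submodule k R)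
  (U : ∀ i, Submodule k (𝒜 i))

/-- The right ideal generated by the `U i` with `i ≥ 1`. -/
def genIdeal : Submodule k R :=
  Submodule.span k {z | ∃ (i : ℕ) (x : 𝒜 (i + 1)), x ∈ U (i + 1) ∧ ∃ a : R, z = x * a}

/-- The sum contains the generators, those of degree `0` being zero, and is closed under products:
`(r + z) y = r y + z y`, where `z y` stays in the right ideal. -/
lemma span_one_sup_genIdeal (h0 : U 0 = ⊥)
    (hU : Algebra.adjoin k {a | ∃ (i : ℕ) (x : 𝒜 i), x ∈ U i ∧ (x : R) = a} = ⊤) :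
    Submodule.span k {(1 : R)} ⊔ genIdeal 𝒜 U = ⊤ := by
  have hI : ∀ x ∈ genIdeal 𝒜 U, ∀ y : R, x * y ∈ genIdeal 𝒜 U := by
    intro x hx y
    induction hx using Submodule.span_induction with
    | mem x hx =>
      obtain ⟨i, u, hu, a, rfl⟩ := hx
      exact Submodule.subset_span ⟨i, u, hu, a * y, mul_assoc _ _ _⟩
    | zero => simp
    | add x z _ _ hx hz => rw [add_mul]; exact add_mem hx hz
    | smul c x _ hx => rw [smul_mul_assoc]; exact Submodule.smul_mem _ _ hx
  refine top_le_iff.1 fun x _ => ?_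
  have hx : x ∈ Algebra.adjoin k {a | ∃ (i : ℕ) (x : 𝒜 i), x ∈ U i ∧ (x : R) = a} := by
    rw [hU]; trivial
  induction hx using Algebra.adjoin_induction with
  | mem x hx =>
    obtain ⟨i, u, hu, rfl⟩ := hx
    cases i with
    | zero =>
      rw [h0, Submodule.mem_bot] at hu
      rw [hu]
      exact zero_mem _
    | succ i =>
      exact Submodule.mem_sup_right (Submodule.subset_span ⟨i, u, hu, 1, (mul_one _).symm⟩)
  | algebraMap r =>
    rw [Algebra.algebraMap_eq_smul_one]
    exact Submodule.mem_sup_left (Submodule.smul_mem _ _ (Submodule.mem_span_singleton_self 1))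
  | add x y _ _ hx hy => exact add_mem (hx trivial) (hy trivial)
  | mul x y _ _ hx hy =>
    obtain ⟨c, hc, z, hz, rfl⟩ := Submodule.mem_sup.1 (hx trivial)
    obtain ⟨r, rfl⟩ := Submodule.mem_span_singleton.1 hc
    rw [add_mul, smul_mul_assoc, one_mul]
    exact add_mem (Submodule.smul_mem _ _ (hy trivial)) (Submodule.mem_sup_right (hI z hz y))

variable [GradedAlgebra 𝒜]

/-- The part of degree `n + 1` of the right ideal generated by the `U i` with `i ≥ 1`. -/
def genDegree (n : ℕ) : Submodule k R :=
  Submodule.span k {z | ∃ (i : Fin (n + 1)) (x : 𝒜 (i + 1)), x ∈ U (i + 1) ∧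
    ∃ a ∈ 𝒜 (n - i), z = x * a}

/-- For `u` of degree `i + 1`, the component of `u a` in degree `n + 1` is `u` times the component
of `a` in degree `n - i`, or `0` if `i > n`. Hence the right factors can be taken homogeneous. -/
lemma decompose_genIdeal (x : R) (hx : x ∈ genIdeal 𝒜 U) (n : ℕ) :
    (DirectSum.decompose 𝒜 x (n + 1) : R) ∈ genDegree 𝒜 U n := by
  induction hx using Submodule.span_induction with
  | mem x hx =>
    obtain ⟨i, u, hu, a, rfl⟩ := hx
    rw [DirectSum.coe_decompose_mul_of_left_mem 𝒜 (n + 1) u.2]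
    split_ifs with h
    · refine Submodule.subset_span ⟨⟨i, by omega⟩, u, hu, _, ?_, rfl⟩
      have : n + 1 - (i + 1) = n - i := by omega
      rw [← this]
      exact SetLike.coe_mem _
    · exact zero_mem _
  | zero => simp
  | add x z _ _ hx hz => simpa [DirectSum.decompose_add] using add_mem hx hz
  | smul c x _ hx =>
    rw [DirectSum.decompose_smul]
    exact Submodule.smul_mem _ c hx

lemma decompose_zero_genIdeal (x : R) (hx : x ∈ genIdeal 𝒜 U) :
    (DirectSum.decompose 𝒜 x 0 : R) = 0 := by
  induction hx using Submodule.span_induction with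
  | mem x hx =>
    obtain ⟨i, u, hu, a, rfl⟩ := hx
    rw [DirectSum.coe_decompose_mul_of_left_mem 𝒜 0 u.2]
    simp
  | zero => simp
  | add x z _ _ hx hz => simp [DirectSum.decompose_add, hx, hz]
  | smul c x _ hx =>
    rw [DirectSum.decompose_smul]
    exact (congrArg (c • ·) hx).trans (smul_zero c)

variable {U}

lemma degree_zero_le_span_one (h0 : U 0 = ⊥)
    (hU : Algebra.adjoin k {a | ∃ (i : ℕ) (x : 𝒜 i), x ∈ U i ∧ (x : R) = a} = ⊤) :
    𝒜 0 ≤ Submodule.span k {(1 : R)} := by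
  intro x hx
  obtain ⟨c, hc, z, hz, rfl⟩ := Submodule.mem_sup.1
    (show x ∈ Submodule.span k {(1 : R)} ⊔ genIdeal 𝒜 U by
      rw [span_one_sup_genIdeal 𝒜 U h0 hU]; trivial)
  obtain ⟨r, rfl⟩ := Submodule.mem_span_singleton.1 hc
  have h1 : (r • (1 : R)) ∈ 𝒜 0 := Submodule.smul_mem _ _ SetLike.GradedOne.one_mem
  rw [← DirectSum.decompose_of_mem_same 𝒜 hx, DirectSum.decompose_add, DirectSum.add_apply,
    Submodule.coe_add, decompose_zero_genIdeal 𝒜 U z hz, add_zero,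
    DirectSum.decompose_of_mem_same 𝒜 h1]
  exact hc

lemma degree_succ_le_genDegree (h0 : U 0 = ⊥)
    (hU : Algebra.adjoin k {a | ∃ (i : ℕ) (x : 𝒜 i), x ∈ U i ∧ (x : R) = a} = ⊤) (n : ℕ) :
    𝒜 (n + 1) ≤ genDegree 𝒜 U n := by
  intro x hx
  obtain ⟨c, hc, z, hz, rfl⟩ := Submodule.mem_sup.1
    (show x ∈ Submodule.span k {(1 : R)} ⊔ genIdeal 𝒜 U by
      rw [span_one_sup_genIdeal 𝒜 U h0 hU]; trivial)
  obtain ⟨r, rfl⟩ := Submodule.mem_span_singleton.1 hc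
  have h1 : (r • (1 : R)) ∈ 𝒜 0 := Submodule.smul_mem _ _ SetLike.GradedOne.one_mem
  rw [← DirectSum.decompose_of_mem_same 𝒜 hx, DirectSum.decompose_add, DirectSum.add_apply,
    Submodule.coe_add, DirectSum.decompose_of_mem_ne 𝒜 h1 (Nat.succ_ne_zero n).symm, zero_add]
  exact decompose_genIdeal 𝒜 U z hz n

/-- Multiplication `U i ⊗ 𝒜 j → 𝒜 n` for `i + j = n`. -/
def mulDegree {i j n : ℕ} (h : i + j = n) (S : Submodule k (𝒜 i)) : (S ⊗[k] 𝒜 j) →ₗ[k] 𝒜 n :=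
  TensorProduct.lift (LinearMap.mk₂ k
    (fun x a => ⟨(x : 𝒜 i) * a, h ▸ SetLike.GradedMul.mul_mem (x : 𝒜 i).2 a.2⟩)
    (fun _ _ _ => Subtype.ext (by simp [add_mul]))
    (fun _ _ _ => Subtype.ext (by simp))
    (fun _ _ _ => Subtype.ext (by simp [mul_add]))
    (fun _ _ _ => Subtype.ext (by simp)))

/-- The left factor has degree at least `1`, so the right factor has degree `n - i < n + 1`, as an
induction on the degree requires. -/
lemma iSup_range_mulDegree (h0 : U 0 = ⊥)
    (hU : Algebra.adjoin k {a | ∃ (i : ℕ) (x : 𝒜 i), x ∈ U i ∧ (x : R) = a} = ⊤) (n : ℕ) :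
    ⨆ i : Fin (n + 1), LinearMap.range
      (mulDegree 𝒜 (show (i + 1 : ℕ) + (n - i) = n + 1 by omega) (U (i + 1))) = ⊤ := by
  have key : genDegree 𝒜 U n ≤ (⨆ i : Fin (n + 1), LinearMap.range
      (mulDegree 𝒜 (show (i + 1 : ℕ) + (n - i) = n + 1 by omega) (U (i + 1)))).map
        (𝒜 (n + 1)).subtype := by
    rw [genDegree, Submodule.span_le]
    rintro _ ⟨i, x, hx, a, ha, rfl⟩
    exact ⟨_, Submodule.mem_iSup_of_mem i ⟨⟨x, hx⟩ ⊗ₜ ⟨a, ha⟩, rfl⟩, rfl⟩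
  refine top_le_iff.1 fun x _ => ?_
  obtain ⟨y, hy, hyx⟩ := key (degree_succ_le_genDegree 𝒜 h0 hU n x.2)
  rwa [← Subtype.ext hyx]

end Algebra

/-- The morphism of `FI^m` from the empty object. -/
def fromEmpty {m : ℕ} (d : FIm m) : stdObj (fun _ => 0) ⟶ d := fun _ =>
  (⟨fun x => Fin.elim0 x, fun x => Fin.elim0 x⟩ : Fin 0 ↪ _)

theorem finiteType_of_generatedBy {m : ℕ} (A : FIm m ⥤ GrAlg.{u, w} k)
    (V : ∀ i : ℕ, SubMod (A ⋙ GrAlg.toGradedModule ⋙ GradedObject.eval i))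
    (h0 : ∀ d, (V 0).carrier d = ⊥) (hA : GeneratedBy A V) (hV : ∀ i, FinGen (V i).toFunctor) :
    FiniteType (A ⋙ GrAlg.toGradedModule) := by
  intro n
  induction n using Nat.strong_induction_on with
  | _ n ih =>
  cases n with
  | zero =>
    -- The generator is `1` on the empty object, which maps to every object; algebra maps preserve
    -- `1`.
    refine finGen_iff.2 ⟨{⟨stdObj fun _ => 0, ⟨1, SetLike.GradedOne.one_mem⟩⟩},
      Set.finite_singleton _, fun d => top_le_iff.1 fun x _ => ?_⟩
    obtain ⟨x, hx⟩ := x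
    obtain ⟨r, rfl⟩ := Submodule.mem_span_singleton.1
      (degree_zero_le_span_one (A.obj d).grading (h0 d) (hA d) hx)
    refine Submodule.smul_mem _ r (mem_span_orbit
      (V := (A ⋙ GrAlg.toGradedModule) ⋙ GradedObject.eval 0)
      (x := ⟨stdObj fun _ => 0, ⟨1, SetLike.GradedOne.one_mem⟩⟩) (Set.mem_singleton _)
      (fromEmpty d) (y := (⟨1, SetLike.GradedOne.one_mem⟩ : (A.obj d).grading 0)) ?_)
    exact Subtype.ext (map_one (A.map (fromEmpty d) :
      (A.obj _).grading →ₐᵍ[k] (A.obj d).grading).toAlgHom)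
  | succ n =>
    refine finGen_of_iSup_range (ι := Fin (n + 1))
      (fun i => tensor (V (i + 1)).toFunctor
        ((A ⋙ GrAlg.toGradedModule) ⋙ GradedObject.eval (n - i)))
      (fun i => finGen_tensor (hV _) (ih _ (by omega)))
      (fun i d => mulDegree (A.obj d).grading (show (i + 1 : ℕ) + (n - i) = n + 1 by omega)
        ((V (i + 1)).carrier d)) (fun i {c d} f x => ?_)
      (fun d => iSup_range_mulDegree (A.obj d).grading (h0 d) (hA d) n)
    let W := tensor (V (i + 1)).toFunctor
      ((A ⋙ GrAlg.toGradedModule) ⋙ GradedObject.eval (n - i : ℕ))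
    let W' := (A ⋙ GrAlg.toGradedModule) ⋙ GradedObject.eval (n + 1)
    have hi : (i + 1 : ℕ) + (n - i) = n + 1 := by omega
    exact LinearMap.congr_fun
      (f := mulDegree (A.obj d).grading hi ((V (i + 1)).carrier d) ∘ₗ (W.map f).hom)
      (g := (W'.map f).hom ∘ₗ mulDegree (A.obj c).grading hi ((V (i + 1)).carrier c))
      (TensorProduct.ext' fun x a => Subtype.ext (map_mul (A.map f :
        (A.obj c).grading →ₐᵍ[k] (A.obj d).grading).toAlgHom _ _).symm) x

end GeneratedAlgebra

/-! ### Tensor powers are of finite type -/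

section TensorPowersFiniteType

variable {k : Type u} [Field k]

/-- Entries are expanded one position at a time; `T` contains the positions whose entry is not yet
known to lie in `S i` itself. -/
lemma multilinear_mem_span {ι : Type*} [Finite ι] {M : ι → Type*} {N : Type*}
    [∀ i, AddCommGroup (M i)] [∀ i, Module k (M i)] [AddCommGroup N] [Module k N]
    (f : MultilinearMap k M N) (S : ∀ i, Set (M i)) (x : ∀ i, M i)
    (hx : ∀ i, x i ∈ Submodule.span k (S i)) :
    f x ∈ Submodule.span k {z | ∃ y : ∀ i, M i, (∀ i, y i ∈ S i) ∧ z = f y} := by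
  classical
  have := Fintype.ofFinite ι
  suffices h : ∀ (T : Finset ι) (x : ∀ i, M i), (∀ i, x i ∈ Submodule.span k (S i)) →
      (∀ i ∉ T, x i ∈ S i) →
      f x ∈ Submodule.span k {z | ∃ y : ∀ i, M i, (∀ i, y i ∈ S i) ∧ z = f y} from
    h Finset.univ x hx fun i hi => absurd (Finset.mem_univ i) hi
  intro T
  induction T using Finset.induction_on with
  | empty => exact fun x _ h => Submodule.subset_span ⟨x, fun i => h i (Finset.notMem_empty i), rfl⟩
  | insert a T _ ih =>
    intro x hx hT
    have key : ∀ y ∈ Submodule.span k (S a), f (Function.update x a y) ∈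
        Submodule.span k {z | ∃ y : ∀ i, M i, (∀ i, y i ∈ S i) ∧ z = f y} := by
      intro y hy
      induction hy using Submodule.span_induction with
      | mem y hy =>
        refine ih _ (fun i => ?_) (fun i hi => ?_) <;> rcases eq_or_ne i a with rfl | h
        · simpa using Submodule.subset_span hy
        · simpa [h] using hx i
        · simpa using hy
        · simpa [h] using hT i (by simp [h, hi])
      | zero => rw [f.map_update_zero]; exact zero_mem _
      | add y z _ _ hy hz => rw [f.map_update_add]; exact add_mem hy hz
      | smul c y _ hy => rw [f.map_update_smul]; exact Submodule.smul_mem _ _ hy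
    simpa using key (x a) (hx a)

lemma tensorDegree_le_span {ι : Type} [Fintype ι] {M : ι → Type w} [∀ i, AddCommGroup (M i)]
    [∀ i, Module k (M i)] (𝒱 : ∀ i, ℕ → Submodule k (M i)) (B : ∀ i, ℕ → Set (M i))
    (hB : ∀ i n, 𝒱 i n ≤ Submodule.span k (B i n)) (n : ℕ) :
    tensorDegree 𝒱 n ≤ Submodule.span k {z | ∃ (e : ι → ℕ) (x : ∀ i, M i),
      (∀ i, x i ∈ B i (e i)) ∧ ∑ i, e i = n ∧ z = PiTensorProduct.tprod k x} := by
  rw [tensorDegree, Submodule.span_le]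
  rintro _ ⟨e, x, hx, he, rfl⟩
  refine Submodule.span_mono ?_ (multilinear_mem_span (PiTensorProduct.tprod k)
    (fun i => B i (e i)) x fun i => hB i _ (hx i))
  rintro _ ⟨y, hy, rfl⟩
  exact ⟨e, y, hy, he, rfl⟩

variable {W : Type w} [AddCommGroup W] [Module k W]

/-- The tensor product over `i` of the tensors of the families `w i`. -/
def pureTensor {m : ℕ} {d : FIm m} (w : ∀ i, d i → W) : ⨂[k] i : Fin m, ⨂[k] _ : d i, W :=
  PiTensorProduct.tprod k fun i => PiTensorProduct.tprod k (w i)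

lemma nestedDegree_le_span (𝒱 : ℕ → Submodule k W) (B : ℕ → Set W)
    (hB : ∀ n, 𝒱 n ≤ Submodule.span k (B n)) {m : ℕ} (d : FIm m) (n : ℕ) :
    tensorDegree (k := k) (M := fun i : Fin m => ⨂[k] _ : d i, W)
      (fun i => tensorDegree fun _ : d i => 𝒱) n ≤
    Submodule.span k {z | ∃ (e : ∀ i, d i → ℕ) (w : ∀ i, d i → W),
      (∀ i s, w i s ∈ B (e i s)) ∧ ∑ i, ∑ s, e i s = n ∧ z = pureTensor w} := by
  refine (tensorDegree_le_span _ _ (fun i n => tensorDegree_le_span (fun _ : d i => 𝒱)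
    (fun _ => B) (fun _ => hB) n) n).trans (Submodule.span_mono ?_)
  rintro _ ⟨e, x, hx, he, rfl⟩
  choose e' w hw he' hx using hx
  exact ⟨e', w, hw, by simp only [he', he], congrArg (PiTensorProduct.tprod k) (funext hx)⟩

lemma pequivOfEmbedding_symm {S T : Type} (f : S ↪ T) (s : S) :
    (pequivOfEmbedding f).symm (f s) = some s :=
  (pequivOfEmbedding f).eq_some_iff.2 rfl

lemma pequivOfEmbedding_symm_eq_none {S T : Type} (f : S ↪ T) (t : T) (h : ∀ s, f s ≠ t) :
    (pequivOfEmbedding f).symm t = none := by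
  rcases hs : (pequivOfEmbedding f).symm t with _ | s
  · rfl
  · exact absurd (Option.some.inj ((pequivOfEmbedding f).eq_some_iff.1 hs)) (h s)

/-- An embedding is defined everywhere, so nothing is contracted and only the insertion of `u` off
the image remains. This exhibits a tensor with many factors `u` as coming from a smaller object. -/
lemma sharpMap_embedding (ε : W →ₗ[k] k) (u : W) {S T : Type} [Fintype S] [Fintype T] (f : S ↪ T)
    (w : T → W) (hw : ∀ t, (∀ s, f s ≠ t) → w t = u) :
    sharpMap ε u (pequivOfEmbedding f) (PiTensorProduct.tprod k (w ∘ f)) =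
      PiTensorProduct.tprod k w := by
  rw [sharpMap_tprod]
  have h1 : ∀ s, ((pequivOfEmbedding f) s).isSome = true := fun s => rfl
  simp only [h1, if_true, Finset.prod_const_one, one_smul]
  congr 1
  funext t
  by_cases h : ∃ s, f s = t
  · obtain ⟨s, rfl⟩ := h
    rw [pequivOfEmbedding_symm]
    rfl
  · push Not at h
    rw [pequivOfEmbedding_symm_eq_none f t h, hw t h]
    rfl

theorem finiteType_tensorPowers (m : ℕ) (𝒱 : ℕ → Submodule k W) [DirectSum.Decomposition 𝒱]
    (e : 𝒱 0 ≃ₗ[k] k) (h𝒱 : ∀ i, Module.Finite k (𝒱 i)) :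
    FiniteType (toSharpm m ⋙ tensorPowers 𝒱 e m) := by
  classical
  intro n
  have h𝒱' : ∀ i, ∃ s : Set W, s.Finite ∧ Submodule.span k s = 𝒱 i := fun i =>
    Submodule.fg_def.1 (Module.Finite.iff_fg.1 (h𝒱 i))
  choose B' hB' hspan using h𝒱'
  -- In degree `0` the spanning set is the unit alone, so every position of degree `0` in a spanning
  -- tensor carries exactly the unit.
  let B : ℕ → Set W := fun i => if i = 0 then {unit0 𝒱 e} else B' i
  have hBfin : ∀ i, (B i).Finite := fun i => by
    by_cases h : i = 0
    · simp [B, h]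
    · simpa [B, h] using hB' i
  have hB : ∀ i, 𝒱 i ≤ Submodule.span k (B i) := fun i => by
    by_cases h : i = 0
    · subst h
      intro x hx
      refine Submodule.mem_span_singleton.2 ⟨e ⟨x, hx⟩, ?_⟩
      change ((e ⟨x, hx⟩ • e.symm 1 : 𝒱 0) : W) = x
      rw [← map_smul, smul_eq_mul, mul_one, e.symm_apply_apply]
    · simpa [B, h] using (hspan i).ge
  have hB𝒱 : ∀ i, B i ⊆ 𝒱 i := fun i => by
    by_cases h : i = 0
    · subst h
      exact Set.singleton_subset_iff.2 (unit0_mem 𝒱 e)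
    · rw [← hspan i]
      simp [B, h]
  let V : FIm m ⥤ ModuleCat k := (toSharpm m ⋙ tensorPowers 𝒱 e m) ⋙ GradedObject.eval n
  -- The total degree is not prescribed in `Y`; the preimage under `Subtype.val` below selects the
  -- tensors of degree `n`.
  let Y : ∀ d : FIm m, Set (⨂[k] i : Fin m, ⨂[k] _ : d i, W) := fun d =>
    pureTensor '' {w | ∀ i s, w i s ∈ ⋃ j ∈ Set.Iic n, B j}
  have hY : ∀ d, (Y d).Finite := fun d => Set.Finite.image _ <| by
    have := Set.Finite.pi' fun i : Fin m => Set.Finite.pi' fun _ : d i =>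
      (Set.finite_Iic n).biUnion fun j _ => hBfin j
    exact this
  refine finGen_iff.2 ⟨⋃ a ∈ Set.Iic fun _ : Fin m => n,
    (fun y : V.obj (stdObj a) => (⟨stdObj a, y⟩ : Σ c, V.obj c)) '' (Subtype.val ⁻¹' Y (stdObj a)),
    (Set.finite_Iic _).biUnion fun a _ => ((hY _).preimage
      Subtype.val_injective.injOn).image _, fun d => top_le_iff.1 ?_⟩
  have key : tensorDegree (k := k) (M := fun i : Fin m => ⨂[k] _ : d i, W)
      (fun i => tensorDegree fun _ : d i => 𝒱) n ≤
      (Submodule.span k (orbit (V := V) (⋃ a ∈ Set.Iic fun _ : Fin m => n,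
        (fun y : V.obj (stdObj a) => (⟨stdObj a, y⟩ : Σ c, V.obj c)) ''
          (Subtype.val ⁻¹' Y (stdObj a))) d)).map (Submodule.subtype _) := by
    refine (nestedDegree_le_span 𝒱 B hB d n).trans (Submodule.span_le.2 ?_)
    rintro _ ⟨ε, w, hw, hε, rfl⟩
    have hle : ∀ i, ∑ s, ε i s ≤ n := fun i => hε ▸
      Finset.single_le_sum (f := fun i => ∑ s, ε i s) (fun _ _ => Nat.zero_le _)
        (Finset.mem_univ i)
    -- `g` has as image the positions of nonzero degree; all other positions carry the unit.
    obtain ⟨g, hg⟩ := exists_stdObj_hom fun i => Finset.univ.filter fun s => ε i s ≠ 0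
    have hzero : ∀ i t, (∀ s, FIm.emb g i s ≠ t) → ε i t = 0 := fun i t h => by
      by_contra h0
      obtain ⟨s, hs⟩ := (hg i t).1 (by simpa using h0)
      exact h s hs
    have hsum : ∀ i, ∑ s, ε i (FIm.emb g i s) = ∑ t, ε i t := fun i => by
      rw [← Finset.sum_map Finset.univ (FIm.emb g i) (ε i)]
      refine Finset.sum_subset (Finset.subset_univ _) fun t _ ht => hzero i t fun s hs => ht ?_
      exact Finset.mem_map.2 ⟨s, Finset.mem_univ s, hs⟩
    have hmem : pureTensor (fun i s => w i (FIm.emb g i s)) ∈ tensorDegree (k := k)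
        (M := fun i : Fin m => ⨂[k] _ : stdObj _ i, W)
        (fun i => tensorDegree fun _ : stdObj _ i => 𝒱) n :=
      Submodule.subset_span ⟨fun i => ∑ s, ε i (FIm.emb g i s), _, fun i =>
        Submodule.subset_span ⟨fun s => ε i (FIm.emb g i s), _, fun s => hB𝒱 _ (hw _ _), rfl, rfl⟩,
        by simp only [hsum, hε], rfl⟩
    have hmap : tensorPowerMap 𝒱 e ((toSharpm m).map g)
        (pureTensor fun i s => w i (FIm.emb g i s)) = pureTensor w := by
      refine (PiTensorProduct.map_tprod _ _).trans
        (congrArg (PiTensorProduct.tprod k) (funext fun i => ?_))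
      refine sharpMap_embedding _ _ (FIm.emb g i) (w i) fun t ht => ?_
      have := hw i t
      rw [hzero i t ht] at this
      simpa [B] using this
    have hd : pureTensor w ∈ tensorDegree (k := k) (M := fun i : Fin m => ⨂[k] _ : d i, W)
        (fun i => tensorDegree fun _ : d i => 𝒱) n :=
      Submodule.subset_span ⟨fun i => ∑ s, ε i s, _, fun i =>
        Submodule.subset_span ⟨ε i, _, fun s => hB𝒱 _ (hw _ _), rfl, rfl⟩, hε, rfl⟩
    refine ⟨⟨pureTensor w, hd⟩, mem_span_orbit (V := V) (x := ⟨stdObj _, ⟨_, hmem⟩⟩) ?_ g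
      (Subtype.ext hmap), rfl⟩
    refine Set.mem_biUnion (Set.mem_Iic.2 fun i => ?_)
      (Set.mem_image_of_mem _ ⟨_, fun i s => ?_, rfl⟩)
    -- Every selected position contributes at least `1` to a total degree of `n`, so each component
    -- has at most `n` of them.
    · rw [Finset.card_eq_sum_ones]
      refine le_trans (Finset.sum_le_sum fun s hs => ?_)
        ((Finset.sum_le_sum_of_subset (Finset.filter_subset _ _)).trans (hle i))
      exact Nat.one_le_iff_ne_zero.2 (Finset.mem_filter.1 hs).2
    · exact Set.mem_biUnion (Set.mem_Iic.2 ((Finset.single_le_sum (f := ε i)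
        (fun _ _ => Nat.zero_le _) (Finset.mem_univ _)).trans (hle i))) (hw i _)
  rintro ⟨x, hx⟩ -
  obtain ⟨y, hy, rfl⟩ := key hx
  exact hy

end TensorPowersFiniteType

/-! ### Simplicial operators given by functions on the natural numbers -/

section SimplicialOperators

/-- The simplicial operator `[p] → [n]` obtained from `a : ℕ → ℕ`, which is `j ↦ a j` if `a` is
monotone with values at most `n` on `[p]`. -/
def natHom (p n : ℕ) (a : ℕ → ℕ) : SimplexCategory.mk p ⟶ SimplexCategory.mk n :=
  SimplexCategory.mkHom
    { toFun := fun j => ⟨min (partialSups a j) n, by omega⟩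
      monotone' := fun i j hij =>
        Fin.mk_le_mk.2 (min_le_min_right n ((partialSups a).monotone hij)) }

/-- For monotone `a` the running suprema in `natHom` change nothing. Together with the cut-off at
`n`, they let operators be written as plain functions on `ℕ`, without proofs of bounds. -/
lemma natHom_val {p n : ℕ} {a : ℕ → ℕ} (ha : Monotone a) (j : Fin (p + 1)) :
    ((natHom p n a).toOrderHom j : ℕ) = min (a j) n := by
  change min (partialSups a j) n = _
  rw [ha.partialSups_eq]

variable {K L : SSet.{w}}

/-- The action on simplices of the operator `[p] → [n]` obtained from `a : ℕ → ℕ`. -/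
def act {n : ℕ} (p : ℕ) (a : ℕ → ℕ) (σ : K.obj (op (.mk n))) : K.obj (op (.mk p)) :=
  K.map (natHom p n a).op σ

/-- Reduces simplicial identities to arithmetic on `ℕ`. Only the intermediate bound `a j ≤ q` has to
be checked, because the cut-off at `n` is the same on both sides. -/
lemma act_act {n p q : ℕ} {a b c : ℕ → ℕ} (ha : Monotone a) (hb : Monotone b) (hc : Monotone c)
    (h : ∀ j ≤ p, a j ≤ q ∧ b (a j) = c j) (σ : K.obj (op (.mk n))) :
    act p a (act q b σ) = act p c σ := by
  rw [act, act, map_map]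
  refine congrArg (fun f => K.map (Quiver.Hom.op f) σ) (hom_ext_val fun j => ?_)
  rw [natHom_val hc]
  refine (natHom_val hb _).trans ?_
  obtain ⟨h1, h2⟩ := h j (Nat.lt_succ_iff.1 j.2)
  rw [natHom_val ha, min_eq_left h1, h2]

lemma act_act_eq {n p q r : ℕ} {a b a' b' : ℕ → ℕ} (ha : Monotone a) (hb : Monotone b)
    (ha' : Monotone a') (hb' : Monotone b')
    (h : ∀ j ≤ p, a j ≤ q ∧ a' j ≤ r ∧ b (a j) = b' (a' j)) (σ : K.obj (op (.mk n))) :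
    act p a (act q b σ) = act p a' (act r b' σ) :=
  (act_act (c := b ∘ a) ha hb (hb.comp ha) (fun j hj => ⟨(h j hj).1, rfl⟩) σ).trans
    (act_act ha' hb' (hb.comp ha) (fun j hj => ⟨(h j hj).2.1, (h j hj).2.2.symm⟩) σ).symm

lemma map_eq_act {n p : ℕ} (f : SimplexCategory.mk p ⟶ SimplexCategory.mk n) {a : ℕ → ℕ}
    (ha : Monotone a) (h : ∀ j : Fin (p + 1), (f.toOrderHom j : ℕ) = a j)
    (σ : K.obj (op (.mk n))) : K.map f.op σ = act p a σ := by
  refine congrArg (fun f => K.map (Quiver.Hom.op f) σ) (hom_ext_val fun j => ?_)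
  have := (f.toOrderHom j).2
  rw [natHom_val ha, ← h, min_eq_left]
  exact Nat.lt_succ_iff.1 (f.toOrderHom j).2

lemma act_congr {n p : ℕ} {a b : ℕ → ℕ} (ha : Monotone a) (hb : Monotone b)
    (h : ∀ j ≤ p, a j = b j) (σ : K.obj (op (.mk n))) : act p a σ = act p b σ := by
  refine congrArg (fun f => K.map (Quiver.Hom.op f) σ) (hom_ext_val fun j => ?_)
  rw [natHom_val ha, natHom_val hb, h j (Nat.lt_succ_iff.1 j.2)]

lemma act_self {n : ℕ} {a : ℕ → ℕ} (ha : Monotone a) (h : ∀ j ≤ n, a j = j)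
    (σ : K.obj (op (.mk n))) : act n a σ = σ := by
  rw [← map_eq_act (𝟙 _) ha (fun j => (h j (Nat.lt_succ_iff.1 j.2)).symm) σ, op_id,
    Functor.map_id_apply]

lemma app_act (f : K ⟶ L) {n p : ℕ} (a : ℕ → ℕ) (σ : K.obj (op (.mk n))) :
    f.app _ (act p a σ) = act p a (f.app _ σ) :=
  NatTrans.naturality_apply f (natHom p n a).op σ

/-- The operator that skips `i`. -/
def skip (i j : ℕ) : ℕ := if j < i then j else j + 1

lemma skip_mono (i : ℕ) : Monotone (skip i) := fun a b h => by
  unfold skip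
  split <;> split <;> omega

lemma skip_le {i j n : ℕ} (h : j ≤ n) : skip i j ≤ n + 1 := by
  unfold skip
  split <;> omega

lemma add_mono (p : ℕ) : Monotone (p + ·) := fun a b h => by
  change p + a ≤ p + b
  omega

variable {k : Type u} [Field k]

lemma coboundary_act {n : ℕ} (φ : Cochain k K n) (σ : K.obj (op (.mk (n + 1)))) :
    coboundary k K n φ σ = ∑ i ∈ Finset.range (n + 2), (-1) ^ i * φ (act n (skip i) σ) := by
  rw [coboundary_apply]
  refine Finset.sum_congr rfl fun i _ => ?_
  rw [map_eq_act (faceMap n i) (skip_mono i) (fun j => rfl)]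

lemma cup_act {p q n : ℕ} (h : p + q = n) (φ : Cochain k K p) (ψ : Cochain k K q)
    (σ : K.obj (op (.mk n))) : cup k K h φ ψ σ = φ (act p id σ) * ψ (act q (p + ·) σ) := by
  rw [cup_apply, map_eq_act _ monotone_id (fun j => rfl),
    map_eq_act (back h) (add_mono p) (fun j => rfl)]

end SimplicialOperators

/-! ### Graded commutativity of the cup product -/

section GradedCommutative

variable {k : Type u} [Field k] {K : SSet.{w}}

/-- The operator with image `{0, …, i} ∪ {i + q, …}`. -/
def gap (q i j : ℕ) : ℕ := if j ≤ i then j else j - 1 + q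

lemma gap_mono (q i : ℕ) : Monotone (gap q i) := fun a b h => by
  unfold gap
  split <;> split <;> omega

/-- The cup-one product, with a sign convention suited to telescoping. -/
def cupOne {p q : ℕ} (n : ℕ) (φ : Cochain k K p) (ψ : Cochain k K q) : Cochain k K n := fun σ =>
  ∑ i ∈ Finset.range p, (-1) ^ ((q + 1) * (i + 1)) *
    (φ (act p (gap q i) σ) * ψ (act q (i + ·) σ))

/-- The operator with image `{0, …, i - 1} ∪ {i + q, …}`. -/
def jump (q i j : ℕ) : ℕ := if j < i then j else j + q

lemma jump_mono (q i : ℕ) : Monotone (jump q i) := fun a b h => by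
  unfold jump
  split <;> split <;> omega

variable {p q : ℕ} (φ : Cochain k K p) (ψ : Cochain k K q) {n : ℕ} (σ : K.obj (op (.mk (n + 1))))

/-- The faces form three blocks: the deleted vertex lies in `{0, …, i}`, in `{i + 1, …, i + q}`, or
beyond. Within the outer blocks the factor `ψ` is constant. Within the middle block `φ` is constant
and `ψ` runs over the inner faces of the simplex `{i, …, i + q + 1}`, which the cocycle condition
trades for the two outer ones. -/
lemma cupOne_face_sum (h : p + q = n + 1) (hψ : ψ ∈ cocycles k K q)
    {i : ℕ} (hi : i < p) :
    ∑ j ∈ Finset.range (n + 2), (-1) ^ j * (φ (act p (gap q i) (act n (skip j) σ)) *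
      ψ (act q (i + ·) (act n (skip j) σ))) =
    (∑ j ∈ Finset.range (i + 1), (-1) ^ j * φ (act p (gap q (i + 1) ∘ skip j) σ)) *
        ψ (act q (i + 1 + ·) σ) +
      (-1) ^ i * φ (act p (jump q (i + 1)) σ) *
        ((-1) ^ q * ψ (act q (i + ·) σ) - ψ (act q (i + 1 + ·) σ)) +
      (-1) ^ (q + 1) * (∑ j ∈ Finset.range (p - i), (-1) ^ (i + 2 + j) *
        φ (act p (gap q i ∘ skip (i + 2 + j)) σ)) * ψ (act q (i + ·) σ) := by
  have hg : ∀ x ≤ p, gap q i x ≤ n := fun x hx => by unfold gap; split <;> omega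
  have hb : ∀ x ≤ q, i + x ≤ n := fun x hx => by omega
  have e1 : ∀ j ≤ i, act p (gap q i) (act n (skip j) σ) = act p (gap q (i + 1) ∘ skip j) σ :=
    fun j hj => act_act (gap_mono _ _) (skip_mono _) ((gap_mono _ _).comp (skip_mono _))
      (fun x hx => ⟨hg x hx, by simp only [gap, skip, Function.comp]; grind⟩) σ
  have e2 : ∀ j ≤ i, act q (i + ·) (act n (skip j) σ) = act q (i + 1 + ·) σ :=
    fun j hj => act_act (add_mono _) (skip_mono _) (add_mono _)
      (fun x hx => ⟨hb x hx, by simp only [skip]; grind⟩) σ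
  have e3 : ∀ l < q, act p (gap q i) (act n (skip (i + 1 + l)) σ) = act p (jump q (i + 1)) σ :=
    fun j hj => act_act (gap_mono _ _) (skip_mono _) (jump_mono _ _)
      (fun x hx => ⟨hg x hx, by simp only [gap, skip, jump]; grind⟩) σ
  have e4 : ∀ l < q, act q (i + ·) (act n (skip (i + 1 + l)) σ) =
      act q (skip (l + 1)) (act (q + 1) (i + ·) σ) := fun l hl => by
    rw [act_act (c := (i + ·) ∘ skip (l + 1)) (add_mono _) (skip_mono _)
      ((add_mono _).comp (skip_mono _))
      (fun x hx => ⟨hb x hx, by simp only [skip, Function.comp]; grind⟩),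
      act_act (c := (i + ·) ∘ skip (l + 1)) (skip_mono _) (add_mono _)
      ((add_mono _).comp (skip_mono _)) (fun x hx => ⟨skip_le hx, rfl⟩)]
  have e5 : ∀ l, act p (gap q i) (act n (skip (i + 1 + (q + l))) σ) =
      act p (gap q i ∘ skip (i + 2 + l)) σ :=
    fun l => act_act (gap_mono _ _) (skip_mono _) ((gap_mono _ _).comp (skip_mono _))
      (fun x hx => ⟨hg x hx, by simp only [gap, skip, Function.comp]; grind⟩) σ
  have e6 : ∀ l, act q (i + ·) (act n (skip (i + 1 + (q + l))) σ) = act q (i + ·) σ :=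
    fun l => act_act (add_mono _) (skip_mono _) (add_mono _)
      (fun x hx => ⟨hb x hx, by simp only [skip]; grind⟩) σ
  have e7 : act q (skip 0) (act (q + 1) (i + ·) σ) = act q (i + 1 + ·) σ :=
    act_act (skip_mono _) (add_mono _) (add_mono _)
      (fun x hx => ⟨skip_le hx, by simp only [skip]; grind⟩) σ
  have e8 : act q (skip (q + 1)) (act (q + 1) (i + ·) σ) = act q (i + ·) σ :=
    act_act (skip_mono _) (add_mono _) (add_mono _)
      (fun x hx => ⟨skip_le hx, by simp only [skip]; grind⟩) σ
  have hc := (coboundary_act ψ (act (q + 1) (i + ·) σ)).symm.trans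
    (congrFun (LinearMap.mem_ker.1 hψ) _)
  rw [Finset.sum_range_succ, Finset.sum_range_succ', e7, e8, Pi.zero_apply] at hc
  rw [show n + 2 = (i + 1) + (q + (p - i)) by omega,
    Finset.sum_range_add _ (i + 1) (q + (p - i)), Finset.sum_range_add _ q (p - i)]
  have s1 : ∑ j ∈ Finset.range (i + 1), (-1 : k) ^ j *
      (φ (act p (gap q i) (act n (skip j) σ)) * ψ (act q (i + ·) (act n (skip j) σ))) =
      (∑ j ∈ Finset.range (i + 1), (-1) ^ j * φ (act p (gap q (i + 1) ∘ skip j) σ)) *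
        ψ (act q (i + 1 + ·) σ) := by
    rw [Finset.sum_mul]
    refine Finset.sum_congr rfl fun j hj => ?_
    have hj := Nat.lt_succ_iff.1 (Finset.mem_range.1 hj)
    rw [e1 j hj, e2 j hj, mul_assoc]
  have s2 : ∑ l ∈ Finset.range q, (-1 : k) ^ (i + 1 + l) *
      (φ (act p (gap q i) (act n (skip (i + 1 + l)) σ)) *
        ψ (act q (i + ·) (act n (skip (i + 1 + l)) σ))) =
      (-1) ^ i * φ (act p (jump q (i + 1)) σ) * ∑ l ∈ Finset.range q,
        (-1) ^ (l + 1) * ψ (act q (skip (l + 1)) (act (q + 1) (i + ·) σ)) := by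
    rw [Finset.mul_sum]
    refine Finset.sum_congr rfl fun l hl => ?_
    have hl := Finset.mem_range.1 hl
    rw [e3 l hl, e4 l hl]
    ring
  have s3 : ∑ l ∈ Finset.range (p - i), (-1 : k) ^ (i + 1 + (q + l)) *
      (φ (act p (gap q i) (act n (skip (i + 1 + (q + l))) σ)) *
        ψ (act q (i + ·) (act n (skip (i + 1 + (q + l))) σ))) =
      (-1) ^ (q + 1) * (∑ j ∈ Finset.range (p - i), (-1) ^ (i + 2 + j) *
        φ (act p (gap q i ∘ skip (i + 2 + j)) σ)) * ψ (act q (i + ·) σ) := by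
    rw [Finset.mul_sum, Finset.sum_mul]
    refine Finset.sum_congr rfl fun l _ => ?_
    rw [e5, e6]
    ring
  rw [s1, s2, s3]
  linear_combination (-1) ^ i * φ (act p (jump q (i + 1)) σ) * hc

/-- This is the cocycle condition on the `(p + 1)`-simplex given by `gap q i`; its faces `i` and `i
+ 1`, on the two sides of the gap, are the `jump` terms. -/
lemma gap_cocycle (h : p + q = n + 1) (hφ : φ ∈ cocycles k K p) {i : ℕ} (hi : i ≤ p) :
    (∑ j ∈ Finset.range i, (-1) ^ j * φ (act p (gap q i ∘ skip j) σ)) +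
      (-1) ^ i * φ (act p (jump q i) σ) - (-1) ^ i * φ (act p (jump q (i + 1)) σ) +
      ∑ j ∈ Finset.range (p - i), (-1) ^ (i + 2 + j) *
        φ (act p (gap q i ∘ skip (i + 2 + j)) σ) = 0 := by
  have e1 : ∀ j, act p (skip j) (act (p + 1) (gap q i) σ) = act p (gap q i ∘ skip j) σ := fun j =>
    act_act (skip_mono _) (gap_mono _ _) ((gap_mono _ _).comp (skip_mono _))
      (fun x hx => ⟨skip_le hx, rfl⟩) σ
  have e2 : act p (gap q i ∘ skip i) σ = act p (jump q i) σ :=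
    act_congr ((gap_mono _ _).comp (skip_mono _)) (jump_mono _ _)
      (fun x _ => by simp only [gap, skip, jump, Function.comp]; grind) σ
  have e3 : act p (gap q i ∘ skip (i + 1)) σ = act p (jump q (i + 1)) σ :=
    act_congr ((gap_mono _ _).comp (skip_mono _)) (jump_mono _ _)
      (fun x _ => by simp only [gap, skip, jump, Function.comp]; grind) σ
  have hc := (coboundary_act φ (act (p + 1) (gap q i) σ)).symm.trans
    (congrFun (LinearMap.mem_ker.1 hφ) _)
  simp only [e1] at hc
  rw [show p + 2 = i + 1 + 1 + (p - i) by omega, Finset.sum_range_add, Finset.sum_range_succ,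
    Finset.sum_range_succ, e2, e3, Pi.zero_apply] at hc
  linear_combination hc

lemma coboundary_cupOne (h : p + q = n + 1) (hφ : φ ∈ cocycles k K p) (hψ : ψ ∈ cocycles k K q) :
    coboundary k K n (cupOne n φ ψ) =
      (-1 : k) ^ (p * q) • cup k K h φ ψ - cup k K ((add_comm q p).trans h) ψ φ := by
  funext σ
  -- Closed form of the partial sums: by `gap_cocycle`, adding the next term turns the first summand
  -- for `s` into the one for `s + 1`. The summand that does not depend on `s` becomes `ψ ∪ φ`.
  have key : ∀ s ≤ p, ∑ i ∈ Finset.range s, (-1) ^ ((q + 1) * (i + 1)) *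
      (∑ j ∈ Finset.range (n + 2), (-1) ^ j * (φ (act p (gap q i) (act n (skip j) σ)) *
        ψ (act q (i + ·) (act n (skip j) σ)))) =
      (-1) ^ ((q + 1) * s) * ((∑ j ∈ Finset.range s, (-1) ^ j *
        φ (act p (gap q s ∘ skip j) σ)) + (-1) ^ s * φ (act p (jump q s) σ)) *
        ψ (act q (s + ·) σ) - φ (act p (jump q 0) σ) * ψ (act q (0 + ·) σ) := by
    intro s hs
    induction s with
    | zero => simp
    | succ s ih =>
      rw [Finset.sum_range_succ, ih (by omega), cupOne_face_sum φ ψ σ h hψ hs]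
      have := gap_cocycle φ σ h hφ (i := s) (by omega)
      have hT : ((-1 : k) ^ q) ^ 2 = 1 := by rw [← pow_mul, mul_comm, pow_mul]; simp
      rw [show (-1 : k) ^ ((q + 1) * (s + 1)) = (-1) ^ ((q + 1) * s) * -(-1) ^ q by ring,
        pow_succ (-1 : k) q, pow_succ (-1 : k) s]
      linear_combination (-1) ^ ((q + 1) * s) * ψ (act q (s + ·) σ) * this +
        (-1) ^ ((q + 1) * s) * ψ (act q (s + ·) σ) *
          (∑ j ∈ Finset.range (p - s), (-1) ^ (s + 2 + j) *
            φ (act p (gap q s ∘ skip (s + 2 + j)) σ) -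
            (-1) ^ s * φ (act p (jump q (s + 1)) σ)) * hT
  have h1 : coboundary k K n (cupOne n φ ψ) σ = ∑ i ∈ Finset.range p, (-1) ^ ((q + 1) * (i + 1)) *
      (∑ j ∈ Finset.range (n + 2), (-1) ^ j * (φ (act p (gap q i) (act n (skip j) σ)) *
        ψ (act q (i + ·) (act n (skip j) σ)))) := by
    rw [coboundary_act]
    simp only [cupOne, Finset.mul_sum]
    rw [Finset.sum_comm]
    exact Finset.sum_congr rfl fun i _ => Finset.sum_congr rfl fun j _ => by ring
  -- At `s = p` the remaining bracket collapses to `φ` on the front face, up to sign, which gives `φ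
  -- ∪ ψ`.
  have hp := gap_cocycle φ σ h hφ (i := p) le_rfl
  rw [Nat.sub_self, Finset.sum_range_zero, add_zero, sub_eq_zero] at hp
  have e1 : act p (jump q (p + 1)) σ = act p id σ :=
    act_congr (jump_mono _ _) monotone_id (fun x hx => if_pos (by omega)) σ
  have e2 : act p (jump q 0) σ = act p (q + ·) σ :=
    act_congr (jump_mono _ _) (add_mono _) (fun x _ => (if_neg x.not_lt_zero).trans (add_comm x q)) σ
  have e3 : act q (0 + ·) σ = act q id σ :=
    act_congr (add_mono _) monotone_id (fun x hx => zero_add x) σ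
  rw [h1, key p le_rfl, hp, Pi.sub_apply, Pi.smul_apply, cup_act, cup_act, e1, e2, e3]
  have hpp : ((-1 : k) ^ p) ^ 2 = 1 := by rw [← pow_mul, mul_comm, pow_mul]; simp
  rw [show (-1 : k) ^ ((q + 1) * p) = (-1) ^ (p * q) * (-1) ^ p by ring, smul_eq_mul]
  linear_combination (-1) ^ (p * q) * φ (act p id σ) * ψ (act q (p + ·) σ) * hpp

lemma cohMul_comm {p q n : ℕ} (h : p + q = n) (x : Coh k K p) (y : Coh k K q) :
    cohMul k K h x y = (-1 : k) ^ (p * q) • cohMul k K ((add_comm q p).trans h) y x := by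
  induction x using coh_ind with | _ φ hφ
  induction y using coh_ind with | _ ψ hψ
  have hs : ((-1 : k) ^ (p * q)) * (-1) ^ (p * q) = 1 := by
    rw [← mul_pow]; simp
  rw [cohMul_mk, cohMul_mk, ← map_smul]
  refine (Submodule.Quotient.eq _).2 ?_
  change cup k K h φ ψ - (-1 : k) ^ (p * q) • cup k K _ ψ φ ∈ coboundaries k K n
  cases n with
  -- There are no nonzero coboundaries in degree `0`, but here both factors are evaluated at the
  -- same vertex, so the cochains themselves commute.
  | zero =>
    obtain rfl : p = 0 := by omega
    obtain rfl : q = 0 := by omega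
    convert zero_mem (coboundaries k K 0) using 1
    funext σ
    have e : act 0 (0 + ·) σ = act 0 id σ :=
      act_congr (add_mono 0) monotone_id (fun x _ => zero_add x) σ
    rw [Pi.sub_apply, Pi.smul_apply, cup_act, cup_act, e, mul_comm (ψ _)]
    simp
  | succ n =>
    refine ⟨(-1 : k) ^ (p * q) • cupOne n φ ψ, ?_⟩
    rw [map_smul, coboundary_cupOne φ ψ h hφ hψ, smul_sub, smul_smul, hs, one_smul]

theorem isGradedCommutative_cohAlg (K : SSet.{w}) : (cohAlg k K).IsGradedCommutative := by
  rintro p q _ _ ⟨x, rfl⟩ ⟨y, rfl⟩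
  have e1 : (DirectSum.of (Coh k K) p x) * (DirectSum.of (Coh k K) q y) =
      (-1) ^ (p * q) * ((DirectSum.of (Coh k K) q y) * (DirectSum.of (Coh k K) p x)) := by
    rw [DirectSum.of_mul_of, DirectSum.of_mul_of]
    have e2 : GradedMonoid.GMul.mul x y = (-1 : k) ^ (p * q) • cohMul k K (add_comm q p) y x :=
      cohMul_comm rfl x y
    have e3 : DirectSum.of (Coh k K) (q + p) (GradedMonoid.GMul.mul y x) =
        DirectSum.of (Coh k K) (p + q) (cohMul k K (add_comm q p) y x) :=
      DirectSum.of_eq_of_gradedMonoid_eq (mk_cohMul (add_comm q p) y x)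
    rw [e2, e3]
    rcases Nat.even_or_odd (p * q) with h | h <;> simp [h.neg_one_pow]
  exact e1

end GradedCommutative

/-! ### The Künneth theorem

For simplicial sets `K` and `L`, the cochains of `K × L` are compared with the double complex of
the functions on the products of `K_{p+q+1}` and `L_q`, in which the first differential uses the
first `p + 1` vertices of the simplices of `K`, and the second one uses the other `q + 1` vertices
and the vertices of the simplices of `L`. -/

section Kunneth

/-- Sign bookkeeping for a prism homotopy: `F j i` stands for face `j` of the `i`-th simplex of the
prism, and `G i j` for the `i`-th simplex of the prism over face `j`. The terms with `j < i` or `j >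
i + 1` cancel against `G`; those with `j = i` or `j = i + 1` telescope. -/
lemma sum_prism {k : Type*} [Field k] (q : ℕ) (F G : ℕ → ℕ → k)
    (h1 : ∀ i < q, ∀ j ≤ i, F j (i + 1) = G i j)
    (h2 : ∀ i < q, ∀ j ≤ q, i < j → F (j + 1) i = G i j)
    (h3 : ∀ i < q, F (i + 1) (i + 1) = F (i + 1) i) :
    ∑ i ∈ Finset.range (q + 1), (-1) ^ i * ∑ j ∈ Finset.range (q + 2), (-1) ^ j * F j i +
      ∑ j ∈ Finset.range (q + 1), (-1) ^ j * ∑ i ∈ Finset.range q, (-1) ^ i * G i j =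
      F 0 0 - F (q + 1) q := by
  have split : ∀ i ∈ Finset.range (q + 1), (-1 : k) ^ i * ∑ j ∈ Finset.range (q + 2), (-1) ^ j * F j i =
      (-1) ^ i * ∑ j ∈ Finset.range i, (-1) ^ j * F j i + (F i i - F (i + 1) i) +
        (-1) ^ i * ∑ l ∈ Finset.range (q - i), (-1) ^ (i + 2 + l) * F (i + 2 + l) i := by
    intro i hi
    have hi := Finset.mem_range.1 hi
    rw [show q + 2 = i + 1 + 1 + (q - i) by omega, Finset.sum_range_add _ (i + 1 + 1) (q - i),
      Finset.sum_range_succ, Finset.sum_range_succ]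
    have hs : ((-1 : k) ^ i) * (-1) ^ i = 1 := by rw [← mul_pow]; simp
    linear_combination (F i i - F (i + 1) i) * hs
  have tel : ∀ s ≤ q, ∑ i ∈ Finset.range (s + 1), (F i i - F (i + 1) i) =
      F 0 0 - F (s + 1) s := by
    intro s hs
    induction s with
    | zero => simp
    | succ s ih =>
      rw [Finset.sum_range_succ, ih (by omega), h3 s (by omega)]
      ring
  have lower : ∑ i ∈ Finset.range (q + 1), (-1 : k) ^ i * ∑ j ∈ Finset.range i, (-1) ^ j * F j i =
      ∑ i ∈ Finset.range q, -((-1) ^ i * ∑ j ∈ Finset.range (i + 1), (-1) ^ j * G i j) := by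
    rw [Finset.sum_range_succ']
    simp only [Finset.range_zero, Finset.sum_empty, mul_zero, add_zero]
    refine Finset.sum_congr rfl fun i hi => ?_
    rw [pow_succ, mul_neg_one, neg_mul]
    congr 2
    refine Finset.sum_congr rfl fun j hj => ?_
    rw [h1 i (Finset.mem_range.1 hi) j (Nat.lt_succ_iff.1 (Finset.mem_range.1 hj))]
  have upper : ∑ i ∈ Finset.range (q + 1), (-1 : k) ^ i *
      ∑ l ∈ Finset.range (q - i), (-1) ^ (i + 2 + l) * F (i + 2 + l) i =
      ∑ i ∈ Finset.range q, -((-1) ^ i *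
        ∑ l ∈ Finset.range (q - i), (-1) ^ (i + 1 + l) * G i (i + 1 + l)) := by
    rw [Finset.sum_range_succ, Nat.sub_self, Finset.range_zero, Finset.sum_empty, mul_zero,
      add_zero]
    refine Finset.sum_congr rfl fun i hi => ?_
    rw [← mul_neg, ← Finset.sum_neg_distrib]
    congr 1
    refine Finset.sum_congr rfl fun l hl => ?_
    have hl := Finset.mem_range.1 hl
    rw [← h2 i (Finset.mem_range.1 hi) _ (by omega) (by omega),
      show i + 2 + l = i + 1 + l + 1 by omega]
    ring
  have swap : ∑ j ∈ Finset.range (q + 1), (-1 : k) ^ j * ∑ i ∈ Finset.range q, (-1) ^ i * G i j =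
      ∑ i ∈ Finset.range q, ((-1) ^ i * ∑ j ∈ Finset.range (i + 1), (-1) ^ j * G i j +
        (-1) ^ i * ∑ l ∈ Finset.range (q - i), (-1) ^ (i + 1 + l) * G i (i + 1 + l)) := by
    simp only [Finset.mul_sum]
    rw [Finset.sum_comm]
    refine Finset.sum_congr rfl fun i hi => ?_
    have hi := Finset.mem_range.1 hi
    rw [show q + 1 = i + 1 + (q - i) by omega, Finset.sum_range_add _ (i + 1) (q - i)]
    congr 1 <;> exact Finset.sum_congr rfl fun j _ => by ring
  rw [Finset.sum_congr rfl split, Finset.sum_add_distrib, Finset.sum_add_distrib, tel q le_rfl,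
    lower, upper, swap, Finset.sum_add_distrib, Finset.sum_neg_distrib, Finset.sum_neg_distrib]
  ring

/-- The operator that takes the value `i` twice. -/
def dup (i j : ℕ) : ℕ := if j ≤ i then j else j - 1

lemma dup_mono (i : ℕ) : Monotone (dup i) := fun a b h => by
  unfold dup
  split <;> split <;> omega

/-- The operator that collapses `{p, …, p + 1 + i}` to `p`. -/
def cone (p i j : ℕ) : ℕ := if j ≤ p then j else if j ≤ p + 1 + i then p else j - 1

lemma cone_mono (p i : ℕ) : Monotone (cone p i) := fun a b h => by
  unfold cone
  split <;> split <;> (try split) <;> (try split) <;> omega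

/-- The operator that is constant from `p` on. -/
def freeze (p j : ℕ) : ℕ := min j p

lemma freeze_mono (p : ℕ) : Monotone (freeze p) := fun a b h => by
  unfold freeze
  omega

variable {k : Type u} [Field k]

variable (k) in
/-- The double complex. -/
abbrev BiCochain (K L : SSet.{w}) (p q : ℕ) : Type (max u w) :=
  K.obj (op (.mk (p + q + 1))) → L.obj (op (.mk q)) → k

variable {K L : SSet.{w}}

/-- The first differential of the double complex. -/
def diffH (p q : ℕ) : BiCochain k K L p q →ₗ[k] BiCochain k K L (p + 1) q where
  toFun β := fun σ l => ∑ i ∈ Finset.range (p + 2), (-1) ^ i * β (act _ (skip i) σ) l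
  map_add' β γ := by
    funext σ l
    simp [mul_add, Finset.sum_add_distrib]
  map_smul' c β := by
    funext σ l
    simp [Finset.mul_sum, mul_left_comm]

/-- The second differential of the double complex. -/
def diffV (p q : ℕ) : BiCochain k K L p q →ₗ[k] BiCochain k K L p (q + 1) where
  toFun β := fun σ l => ∑ i ∈ Finset.range (q + 2),
    (-1) ^ i * β (act _ (skip (p + 1 + i)) σ) (act q (skip i) l)
  map_add' β γ := by
    funext σ l
    simp [mul_add, Finset.sum_add_distrib]
  map_smul' c β := by
    funext σ l
    simp [Finset.mul_sum, mul_left_comm]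

lemma diffH_apply {p q : ℕ} (β : BiCochain k K L p q) (σ : K.obj (op (.mk (p + 1 + q + 1))))
    (l : L.obj (op (.mk q))) : diffH p q β σ l =
      ∑ i ∈ Finset.range (p + 2), (-1) ^ i * β (act _ (skip i) σ) l := rfl

lemma diffV_apply {p q : ℕ} (β : BiCochain k K L p q) (σ : K.obj (op (.mk (p + (q + 1) + 1))))
    (l : L.obj (op (.mk (q + 1)))) : diffV p q β σ l = ∑ i ∈ Finset.range (q + 2),
      (-1) ^ i * β (act _ (skip (p + 1 + i)) σ) (act q (skip i) l) := rfl

/-- The differentials delete vertices of `σ` from disjoint blocks, and deleting one from the first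
block shifts the second down by one. They commute, so the total differential needs the sign `(-1)^p`
on `diffV`. -/
lemma diffV_diffH {p q : ℕ} (β : BiCochain k K L p q) :
    diffV (p + 1) q (diffH p q β) = diffH p (q + 1) (diffV p q β) := by
  funext σ l
  simp only [diffH_apply, diffV_apply, Finset.mul_sum]
  rw [Finset.sum_comm]
  refine Finset.sum_congr rfl fun i hi => Finset.sum_congr rfl fun j _ => ?_
  have hi := Finset.mem_range.1 hi
  have e : act (p + q + 1) (skip i) (act (p + 1 + q + 1) (skip (p + 1 + 1 + j)) σ) =
      act (p + q + 1) (skip (p + 1 + j)) (act (p + (q + 1) + 1) (skip i) σ) := by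
    rw [act_act (c := skip (p + 1 + 1 + j) ∘ skip i) (skip_mono _) (skip_mono _)
      ((skip_mono _).comp (skip_mono _)) (fun x hx => ⟨by have := skip_le (i := i) hx; omega, rfl⟩),
      act_act (c := skip (p + 1 + 1 + j) ∘ skip i) (skip_mono _) (skip_mono _)
      ((skip_mono _).comp (skip_mono _)) (fun x hx => ⟨by have := skip_le (i := p + 1 + j) hx; omega,
        by simp only [skip, Function.comp]; grind⟩)]
  rw [e]
  ring

/-- The inclusion of the tensor product double complex. -/
def inflate (p q : ℕ) : (K.obj (op (.mk p)) → Cochain k L q) →ₗ[k] BiCochain k K L p q where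
  toFun θ := fun σ l => θ (act p id σ) l
  map_add' _ _ := rfl
  map_smul' _ _ := rfl

/-- The retraction of the columns of the double complex. -/
def deflate (p q : ℕ) : BiCochain k K L p q →ₗ[k] (K.obj (op (.mk p)) → Cochain k L q) where
  toFun β := fun σ l => β (act _ (freeze p) σ) l
  map_add' _ _ := rfl
  map_smul' _ _ := rfl

/-- The contracting homotopy of the columns of the double complex. -/
def columnHomotopy (p q : ℕ) (β : BiCochain k K L p (q + 1)) : BiCochain k K L p q := fun σ l =>
  ∑ i ∈ Finset.range (q + 1), (-1) ^ i * β (act _ (cone p i) σ) (act (q + 1) (dup i) l)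

/-- The boundaries in the columns of the double complex. -/
def columnBoundaries (k : Type u) [Field k] (K L : SSet.{w}) (p : ℕ) :
    ∀ q, Submodule k (BiCochain k K L p q)
  | 0 => ⊥
  | q + 1 => LinearMap.range (diffV p q)

/-- Vertex `p` of `σ` serves as a cone point onto which the last `q + 1` vertices are contracted,
along a prism over `l`. The two ends of the prism are `β` and `inflate (deflate β)`. -/
lemma sub_inflate_deflate_mem {p q : ℕ} (β : BiCochain k K L p q) (hβ : diffV p q β = 0) :
    β - inflate p q (deflate p q β) ∈ columnBoundaries k K L p q := by
  have hF : ∀ (σ : K.obj (op (.mk (p + q + 1)))) (l : L.obj (op (.mk q))) (i : ℕ),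
      ∑ j ∈ Finset.range (q + 2), (-1) ^ j * β
        (act (p + q + 1) (skip (p + 1 + j)) (act (p + (q + 1) + 1) (cone p i) σ))
        (act q (skip j) (act (q + 1) (dup i) l)) = 0 := fun σ l i =>
    congrFun (congrFun hβ _) _
  have e0 : ∀ (σ : K.obj (op (.mk (p + q + 1)))) (l : L.obj (op (.mk q))), β
        (act (p + q + 1) (skip (p + 1 + 0)) (act (p + (q + 1) + 1) (cone p 0) σ))
        (act q (skip 0) (act (q + 1) (dup 0) l)) = β σ l := fun σ l => by
    rw [act_act (c := id) (skip_mono _) (cone_mono _ _) monotone_id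
        (fun x hx => ⟨by have := skip_le (i := p + 1 + 0) hx; omega,
          by simp only [skip, cone, id]; grind⟩),
      act_act (c := id) (skip_mono _) (dup_mono _) monotone_id
        (fun x hx => ⟨skip_le hx, by simp only [skip, dup, id]; grind⟩),
      act_self monotone_id fun _ _ => rfl, act_self monotone_id fun _ _ => rfl]
  have e1 : ∀ (σ : K.obj (op (.mk (p + q + 1)))) (l : L.obj (op (.mk q))), β
        (act (p + q + 1) (skip (p + 1 + (q + 1))) (act (p + (q + 1) + 1) (cone p q) σ))
        (act q (skip (q + 1)) (act (q + 1) (dup q) l)) =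
      inflate p q (deflate p q β) σ l := fun σ l => by
    change _ = β (act _ (freeze p) (act p id σ)) l
    rw [act_act (c := freeze p) (skip_mono _) (cone_mono _ _) (freeze_mono _)
        (fun x hx => ⟨by have := skip_le (i := p + 1 + (q + 1)) hx; omega,
          by simp only [skip, cone, freeze]; grind⟩),
      act_act (c := freeze p) (freeze_mono _) monotone_id (freeze_mono _)
        (fun x hx => ⟨min_le_right _ _, rfl⟩),
      act_act (c := id) (skip_mono _) (dup_mono _) monotone_id
        (fun x hx => ⟨skip_le hx, by simp only [skip, dup, id]; grind⟩),
      act_self monotone_id fun _ _ => rfl]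
  cases q with
  -- For `q = 0` the cocycle condition on the degenerate prism is itself the equality of the two
  -- ends.
  | zero =>
    refine (Submodule.mem_bot k).2 (funext fun σ => funext fun l => ?_)
    have := hF σ l 0
    rw [Finset.sum_range_succ, Finset.sum_range_one, e0, e1] at this
    change β σ l - inflate p 0 (deflate p 0 β) σ l = 0
    linear_combination this
  | succ q =>
    refine ⟨columnHomotopy p q β, funext fun σ => funext fun l => ?_⟩
    have key := sum_prism (q + 1) (fun j i => β
        (act (p + (q + 1) + 1) (skip (p + 1 + j)) (act (p + (q + 1 + 1) + 1) (cone p i) σ))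
        (act (q + 1) (skip j) (act (q + 1 + 1) (dup i) l)))
      (fun i j => β (act (p + (q + 1) + 1) (cone p i) (act (p + q + 1) (skip (p + 1 + j)) σ))
        (act (q + 1) (dup i) (act q (skip j) l))) ?_ ?_ ?_
    · rw [e0, e1] at key
      simp only [hF, mul_zero, Finset.sum_const_zero, zero_add] at key
      exact key
    · intro i hi j hj
      exact congrArg₂ β
        (act_act_eq (skip_mono _) (cone_mono _ _) (cone_mono _ _) (skip_mono _) (fun x hx => by
          simp only [skip, cone]; grind) σ)
        (act_act_eq (skip_mono _) (dup_mono _) (dup_mono _) (skip_mono _) (fun x hx => by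
          simp only [skip, dup]; grind) l)
    · intro i hi j hj hij
      exact congrArg₂ β
        (act_act_eq (skip_mono _) (cone_mono _ _) (cone_mono _ _) (skip_mono _) (fun x hx => by
          simp only [skip, cone]; grind) σ)
        (act_act_eq (skip_mono _) (dup_mono _) (dup_mono _) (skip_mono _) (fun x hx => by
          simp only [skip, dup]; grind) l)
    · intro i hi
      exact congrArg₂ β
        (act_act_eq (skip_mono _) (cone_mono _ _) (skip_mono _) (cone_mono _ _) (fun x hx => by
          simp only [skip, cone]; grind) σ)
        (act_act_eq (skip_mono _) (dup_mono _) (skip_mono _) (dup_mono _) (fun x hx => by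
          simp only [skip, dup]; grind) l)

end Kunneth

/-! ### Cohomology of the columns, and the map from the total complex to cochains of the product -/

section Kunneth

variable {k : Type u} [Field k] {K L : SSet.{w}}

/-- After `freeze p` the vertices from position `p` on all coincide, so deleting one of the last
block affects only `l`. -/
lemma deflate_diffV {p q : ℕ} (β : BiCochain k K L p q) (σ : K.obj (op (.mk p))) :
    deflate p (q + 1) (diffV p q β) σ = coboundary k L q (deflate p q β σ) := by
  funext l
  rw [coboundary_act]
  change ∑ i ∈ Finset.range (q + 2), (-1 : k) ^ i * β (act _ _ (act _ _ σ)) _ = _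
  refine Finset.sum_congr rfl fun i _ => ?_
  change _ = _ * β (act _ _ σ) _
  rw [act_act (c := freeze p) (skip_mono _) (freeze_mono _) (freeze_mono _) (fun x hx =>
    ⟨by have := skip_le (i := p + 1 + i) hx; omega, by simp only [skip, freeze]; grind⟩)]

lemma inflate_coboundary {p q : ℕ} (θ : K.obj (op (.mk p)) → Cochain k L q) :
    diffV p q (inflate p q θ) = inflate p (q + 1) fun σ => coboundary k L q (θ σ) := by
  funext σ l
  change _ = coboundary k L q (θ (act p id σ)) l
  rw [coboundary_act]
  change ∑ i ∈ Finset.range (q + 2), (-1 : k) ^ i * θ (act _ _ (act _ _ σ)) _ = _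
  refine Finset.sum_congr rfl fun i _ => ?_
  rw [act_act (c := id) monotone_id (skip_mono _) monotone_id (fun x hx =>
    ⟨by simp only [id]; omega, by simp only [skip, id]; grind⟩)]

/-- The first differential of the tensor product double complex. -/
def tensorDiffH {p q : ℕ} (θ : K.obj (op (.mk p)) → Cochain k L q) :
    K.obj (op (.mk (p + 1))) → Cochain k L q := fun σ =>
  ∑ i ∈ Finset.range (p + 2), (-1 : k) ^ i • θ (act p (skip i) σ)

lemma diffH_inflate {p q : ℕ} (θ : K.obj (op (.mk p)) → Cochain k L q) :
    diffH p q (inflate p q θ) = inflate (p + 1) q (tensorDiffH θ) := by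
  funext σ l
  change _ = (∑ i ∈ Finset.range (p + 2), (-1 : k) ^ i • θ (act p (skip i) (act _ id σ))) l
  rw [Finset.sum_apply]
  change ∑ i ∈ Finset.range (p + 2), (-1 : k) ^ i * θ (act _ _ (act _ _ σ)) _ = _
  refine Finset.sum_congr rfl fun i _ => ?_
  change _ = _ * θ _ _
  rw [act_act_eq (p := p) (q := p + q + 1) (a := id) (b := skip i) (r := p + 1) (a' := skip i)
    (b' := id) monotone_id (skip_mono _) (skip_mono _) monotone_id (fun x hx =>
    ⟨by simp only [id]; omega, skip_le hx, rfl⟩)]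

lemma deflate_inflate {p q : ℕ} (θ : K.obj (op (.mk p)) → Cochain k L q) :
    deflate p q (inflate p q θ) = θ := by
  funext σ
  change θ (act _ _ (act _ _ σ)) = _
  rw [act_act (c := id) monotone_id (freeze_mono _) monotone_id (fun x hx =>
    ⟨by simp only [id]; omega, by simp only [freeze, id]; omega⟩), act_self monotone_id
    fun _ _ => rfl]

lemma deflate_columnBoundaries {p q : ℕ} (β : BiCochain k K L p q)
    (hβ : β ∈ columnBoundaries k K L p q) (σ : K.obj (op (.mk p))) :
    deflate p q β σ ∈ coboundaries k L q := by
  cases q with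
  | zero =>
    rw [(Submodule.mem_bot k).1 hβ]
    exact zero_mem _
  | succ q =>
    obtain ⟨γ, rfl⟩ := hβ
    exact ⟨_, (deflate_diffV γ σ).symm⟩

lemma inflate_coboundaries {p q : ℕ} (θ : K.obj (op (.mk p)) → Cochain k L q)
    (hθ : ∀ σ, θ σ ∈ coboundaries k L q) : inflate p q θ ∈ columnBoundaries k K L p q := by
  cases q with
  | zero =>
    refine (Submodule.mem_bot k).2 ?_
    rw [show θ = 0 from funext fun σ => (Submodule.mem_bot k).1 (hθ σ), map_zero]
  | succ q =>
    choose α hα using hθ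
    exact ⟨inflate p q α, (inflate_coboundary α).trans (congrArg _ (funext hα))⟩

lemma diffH_columnBoundaries {p q : ℕ} (β : BiCochain k K L p q)
    (hβ : β ∈ columnBoundaries k K L p q) :
    diffH p q β ∈ columnBoundaries k K L (p + 1) q := by
  cases q with
  | zero =>
    rw [(Submodule.mem_bot k).1 hβ, map_zero]
    exact zero_mem _
  | succ q =>
    obtain ⟨γ, rfl⟩ := hβ
    exact ⟨_, diffV_diffH γ⟩

variable (k K L) in
/-- The sums of products of cocycles, in the tensor product double complex. -/
def productCocycles (p q : ℕ) : Submodule k (K.obj (op (.mk p)) → Cochain k L q) :=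
  Submodule.span k {θ | ∃ a ∈ cocycles k K p, ∃ b ∈ cocycles k L q, θ = fun σ => a σ • b}

/-- `deflate p q β` sends each `p`-simplex of `K` to a `q`-cocycle of `L`, whose class has
coordinates `c j` in a basis of `H^q(L)`. By `hH` the alternating sum of these classes over the
faces of a simplex vanishes, so each `c j` is a cocycle. Finiteness of the basis makes `∑ j, c j ⊗ ψ
j` one finite sum, valid for all simplices at once. -/
lemma exists_productCocycles {p q : ℕ} [Module.Finite k (Coh k L q)] (β : BiCochain k K L p q)
    (hV : diffV p q β = 0) (hH : diffH p q β ∈ columnBoundaries k K L (p + 1) q) :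
    ∃ θ ∈ productCocycles k K L p q, β - inflate p q θ ∈ columnBoundaries k K L p q ∧
      tensorDiffH θ = 0 := by
  have h1 := sub_inflate_deflate_mem β hV
  have h2 : ∀ σ, deflate p q β σ ∈ cocycles k L q := fun σ => by
    rw [LinearMap.mem_ker, ← deflate_diffV, hV]
    rfl
  -- `β` and `inflate (deflate β)` differ by a column boundary, and `diffH` preserves column
  -- boundaries.
  have h3 : ∀ σ, tensorDiffH (deflate p q β) σ ∈ coboundaries k L q := fun σ => by
    have := sub_mem hH (diffH_columnBoundaries _ h1)
    rw [← map_sub, sub_sub_cancel, diffH_inflate] at this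
    simpa only [deflate_inflate] using deflate_columnBoundaries _ this σ
  let b := Module.finBasis k (Coh k L q)
  have hb : ∀ j, ∃ ψ : cocycles k L q, cohQ k L q ψ = b j := fun j =>
    Submodule.mkQ_surjective _ (b j)
  choose ψ hψ using hb
  let c : ∀ j, Cochain k K p := fun j σ => b.repr (cohQ k L q ⟨deflate p q β σ, h2 σ⟩) j
  have hc : ∀ j, coboundary k K p (c j) = 0 := fun j => by
    funext σ
    rw [coboundary_act]
    have e : (⟨tensorDiffH (deflate p q β) σ, by
        exact Submodule.sum_mem _ fun i _ => Submodule.smul_mem _ _ (h2 _)⟩ : cocycles k L q) =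
        ∑ i ∈ Finset.range (p + 2), (-1 : k) ^ i •
          ⟨deflate p q β (act p (skip i) σ), h2 (act p (skip i) σ)⟩ := by
      ext1
      simp [tensorDiffH]
    have e2 : cohQ k L q ⟨tensorDiffH (deflate p q β) σ, by
        exact Submodule.sum_mem _ fun i _ => Submodule.smul_mem _ _ (h2 _)⟩ = 0 :=
      (Submodule.Quotient.mk_eq_zero _).2 (h3 σ)
    rw [e, map_sum] at e2
    have e3 := congrArg (fun x => b.repr x j) e2
    simp only [map_sum, map_smul, Finsupp.finsetSum_apply, Finsupp.smul_apply, smul_eq_mul,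
      map_zero, Finsupp.zero_apply] at e3
    exact e3
  refine ⟨fun σ => ∑ j, c j σ • (ψ j : Cochain k L q), ?_, ?_, ?_⟩
  · have : (fun σ => ∑ j, c j σ • (ψ j : Cochain k L q)) =
        ∑ j, fun σ => c j σ • (ψ j : Cochain k L q) := by
      funext σ
      rw [Finset.sum_apply]
    rw [this]
    exact Submodule.sum_mem _ fun j _ => Submodule.subset_span
      ⟨c j, hc j, ψ j, (ψ j).2, rfl⟩
  · have h4 : inflate p q (deflate p q β - fun σ => ∑ j, c j σ • (ψ j : Cochain k L q)) ∈
        columnBoundaries k K L p q := by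
      refine inflate_coboundaries _ fun σ => ?_
      have e : cohQ k L q (⟨deflate p q β σ, h2 σ⟩ - ∑ j, c j σ • ψ j) = 0 := by
        rw [map_sub, map_sum, sub_eq_zero]
        simp only [map_smul, hψ]
        exact (b.sum_repr _).symm
      simpa using (Submodule.Quotient.mk_eq_zero _).1 e
    simpa [map_sub] using add_mem h1 h4
  · funext σ
    have hc' : ∀ j, ∑ i ∈ Finset.range (p + 2), (-1) ^ i * c j (act p (skip i) σ) = 0 := fun j => by
      rw [← coboundary_act, hc]
      rfl
    simp only [tensorDiffH, Finset.smul_sum, smul_smul]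
    rw [Finset.sum_comm]
    simp [← Finset.sum_smul, hc']

variable {P : SSet.{w}} (f : P ⟶ K) (g : P ⟶ L)

/-- The map from the double complex to the cochains of the product. -/
def totalize {p q n : ℕ} (_ : p + q = n) : BiCochain k K L p q →ₗ[k] Cochain k P n where
  toFun β := fun z => β (act _ (dup p) (f.app _ z)) (act q (p + ·) (g.app _ z))
  map_add' _ _ := rfl
  map_smul' _ _ := rfl

lemma totalize_apply {p q n : ℕ} (h : p + q = n) (β : BiCochain k K L p q)
    (z : P.obj (op (.mk n))) :
    totalize f g h β z = β (act _ (dup p) (f.app _ z)) (act q (p + ·) (g.app _ z)) := rfl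

/-- Faces `0, …, p` account for `diffH` and the later ones for `diffV`. The last term of `diffH` and
the first of `diffV` each remove one copy of a doubled vertex, so they agree and cancel by sign.
Thus `totalize` is a cochain map on the total complex. -/
lemma coboundary_totalize {p q n : ℕ} (h : p + q = n) (β : BiCochain k K L p q) :
    coboundary k P n (totalize f g h β) =
      totalize f g (by omega) (diffH p q β) +
        (-1 : k) ^ p • totalize f g (by omega) (diffV p q β) := by
  funext z
  simp only [Pi.add_apply, Pi.smul_apply, totalize_apply, diffH_apply, diffV_apply,
    coboundary_act, app_act]
  generalize f.app (op (.mk (n + 1))) z = σ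
  generalize g.app (op (.mk (n + 1))) z = l
  have e1 : ∀ i < p + 1, act (p + q + 1) (dup p) (act n (skip i) σ) =
      act (p + q + 1) (skip i) (act (p + 1 + q + 1) (dup (p + 1)) σ) := fun i hi =>
    act_act_eq (dup_mono _) (skip_mono _) (skip_mono _) (dup_mono _)
      (fun x hx => by simp only [skip, dup]; grind) σ
  have e2 : ∀ i < p + 1, act q (p + ·) (act n (skip i) l) = act q (p + 1 + ·) l := fun i hi =>
    act_act (add_mono _) (skip_mono _) (add_mono _)
      (fun x hx => ⟨by omega, by simp only [skip]; grind⟩) l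
  have e3 : ∀ i, act (p + q + 1) (dup p) (act n (skip (p + 1 + i)) σ) =
      act (p + q + 1) (skip (p + 1 + (i + 1))) (act (p + (q + 1) + 1) (dup p) σ) := fun i =>
    act_act_eq (dup_mono _) (skip_mono _) (skip_mono _) (dup_mono _)
      (fun x hx => by simp only [skip, dup]; grind) σ
  have e4 : ∀ i, act q (p + ·) (act n (skip (p + 1 + i)) l) =
      act q (skip (i + 1)) (act (q + 1) (p + ·) l) := fun i =>
    act_act_eq (add_mono _) (skip_mono _) (skip_mono _) (add_mono _)
      (fun x hx => by simp only [skip]; grind) l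
  have e5 : act (p + q + 1) (skip (p + 1)) (act (p + 1 + q + 1) (dup (p + 1)) σ) =
      act (p + q + 1) (skip (p + 1 + 0)) (act (p + (q + 1) + 1) (dup p) σ) :=
    act_act_eq (skip_mono _) (dup_mono _) (skip_mono _) (dup_mono _)
      (fun x hx => by simp only [skip, dup]; grind) σ
  have e6 : act q (skip 0) (act (q + 1) (p + ·) l) = act q (p + 1 + ·) l :=
    act_act (skip_mono _) (add_mono _) (add_mono _)
      (fun x hx => ⟨skip_le hx, by simp only [skip]; grind⟩) l
  rw [show n + 2 = (p + 1) + (q + 1) by omega, Finset.sum_range_add _ (p + 1) (q + 1),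
    Finset.sum_range_succ _ (p + 1), Finset.sum_range_succ' _ (q + 1), e5, e6, smul_eq_mul]
  have s1 : ∑ i ∈ Finset.range (p + 1), (-1 : k) ^ i *
      β (act (p + q + 1) (dup p) (act n (skip i) σ)) (act q (p + ·) (act n (skip i) l)) =
      ∑ i ∈ Finset.range (p + 1), (-1 : k) ^ i *
        β (act (p + q + 1) (skip i) (act (p + 1 + q + 1) (dup (p + 1)) σ)) (act q (p + 1 + ·) l) :=
    Finset.sum_congr rfl fun i hi => by
      rw [e1 i (Finset.mem_range.1 hi), e2 i (Finset.mem_range.1 hi)]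
  have s2 : ∑ i ∈ Finset.range (q + 1), (-1 : k) ^ (p + 1 + i) *
      β (act (p + q + 1) (dup p) (act n (skip (p + 1 + i)) σ))
        (act q (p + ·) (act n (skip (p + 1 + i)) l)) =
      (-1) ^ p * ∑ i ∈ Finset.range (q + 1), (-1 : k) ^ (i + 1) *
        β (act (p + q + 1) (skip (p + 1 + (i + 1))) (act (p + (q + 1) + 1) (dup p) σ))
          (act q (skip (i + 1)) (act (q + 1) (p + ·) l)) := by
    rw [Finset.mul_sum]
    exact Finset.sum_congr rfl fun i hi => by
      rw [e3, e4]
      ring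
  rw [s1, s2]
  ring

end Kunneth

/-! ### Zigzags in the double complex and surjectivity of the cross product -/

section Kunneth

/-- The usual cancellation behind `d ∘ d = 0`: for `j ≤ i`, the terms at `(i + 1, j)` and `(j, i)`
have opposite signs. -/
lemma sum_faces_faces {k : Type*} [Field k] (n : ℕ) (H : ℕ → ℕ → k)
    (hH : ∀ i < n, ∀ j ≤ i, H (i + 1) j = H j i) :
    ∑ i ∈ Finset.range (n + 1), (-1) ^ i * ∑ j ∈ Finset.range n, (-1) ^ j * H i j = 0 := by
  have split : ∀ i j, (-1 : k) ^ i * ((-1) ^ j * H i j) =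
      (if j < i then (-1) ^ i * ((-1) ^ j * H i j) else 0) +
        if j < i then 0 else (-1) ^ i * ((-1) ^ j * H i j) := fun i j => by
    split <;> simp
  simp only [Finset.mul_sum]
  rw [Finset.sum_congr rfl fun i _ => Finset.sum_congr rfl fun j _ => split i j]
  simp only [Finset.sum_add_distrib]
  rw [Finset.sum_range_succ', Finset.sum_range_succ, Finset.sum_eq_zero (fun j _ => if_neg
    (Nat.not_lt_zero j)), Finset.sum_eq_zero (s := Finset.range n) (f := fun j => ite (j < n) _ _)
    (fun j hj => if_pos (Finset.mem_range.1 hj)), add_zero, add_zero, add_comm, Finset.sum_comm,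
    ← Finset.sum_add_distrib]
  refine Finset.sum_eq_zero fun i hi => ?_
  rw [← Finset.sum_add_distrib]
  refine Finset.sum_eq_zero fun j _ => ?_
  by_cases h : j ≤ i
  · rw [if_neg (by omega), if_pos (by omega), hH i (Finset.mem_range.1 hi) j h]
    ring
  · rw [if_pos (by omega), if_neg (by omega), add_zero]

variable {k : Type u} [Field k] {K L P : SSet.{w}} (f : P ⟶ K) (g : P ⟶ L)

lemma diffH_diffH {p q : ℕ} (β : BiCochain k K L p q) :
    diffH (p + 1) q (diffH p q β) = 0 := by
  funext σ l
  simp only [diffH_apply]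
  refine sum_faces_faces (p + 2) (fun i j => β (act (p + q + 1) (skip j)
    (act (p + 1 + q + 1) (skip i) σ)) l) fun i hi j hj => ?_
  have e : act (p + q + 1) (skip j) (act (p + 1 + q + 1) (skip (i + 1)) σ) =
      act (p + q + 1) (skip i) (act (p + 1 + q + 1) (skip j) σ) :=
    act_act_eq (skip_mono _) (skip_mono _) (skip_mono _) (skip_mono _)
      (fun x hx => by simp only [skip]; grind) σ
  exact congrArg (β · l) e

variable (k) in
/-- The sums of coboundaries and of cross products of cocycles. -/
def crossSpan (n : ℕ) : Submodule k (Cochain k P n) :=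
  coboundaries k P n ⊔ Submodule.span k {z | ∃ (p q : ℕ) (h : p + q = n),
    ∃ a ∈ cocycles k K p, ∃ b ∈ cocycles k L q,
      z = cup k P h (cochainMap f p a) (cochainMap g q b)}

/-- An inflated function sees only the first `p + 1` vertices, hence not the doubling; what remains
is front face times back face, the cup product. -/
lemma totalize_productCocycles {p q n : ℕ} (h : p + q = n) (θ : K.obj (op (.mk p)) → Cochain k L q)
    (hθ : θ ∈ productCocycles k K L p q) :
    totalize f g h (inflate p q θ) ∈ crossSpan k f g n := by
  induction hθ using Submodule.span_induction with
  | mem θ hθ =>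
    obtain ⟨a, ha, b, hb, rfl⟩ := hθ
    refine Submodule.mem_sup_right (Submodule.subset_span ⟨p, q, h, a, ha, b, hb, ?_⟩)
    funext z
    rw [cup_act]
    change a (act p id (act (p + q + 1) (dup p) (f.app _ z))) * b (act q (p + ·) (g.app _ z)) =
      a (f.app _ (act p id z)) * b (g.app _ (act q (p + ·) z))
    rw [app_act, app_act, act_act (c := id) monotone_id (dup_mono _) monotone_id
      (fun x hx => ⟨by simp only [id]; omega, if_pos hx⟩)]
  | zero => rw [map_zero, map_zero]; exact zero_mem _
  | add x y _ _ hx hy => rw [map_add, map_add]; exact add_mem hx hy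
  | smul c x _ hx => rw [map_smul, map_smul]; exact Submodule.smul_mem _ _ hx

/-- `β` in column `p` is the first component of a total cocycle with components in the columns
`p, p + 1, …`, and `rest` is the contribution of the other components to the cochains of the
product. -/
def Zigzag {n : ℕ} : ∀ (q p : ℕ), p + q = n → BiCochain k K L p q → Cochain k P n → Prop
  | 0, p, _, β, rest => diffH p 0 β = 0 ∧ rest = 0
  | q + 1, p, h, β, rest => ∃ (β' : BiCochain k K L (p + 1) q) (rest' : Cochain k P n),
      diffH p (q + 1) β = (-1 : k) ^ p • diffV (p + 1) q β' ∧
      rest = totalize f g (by omega) β' + rest' ∧ Zigzag q (p + 1) (by omega) β' rest'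

/-- The conditions on the later columns involve `β` only through `diffH p q β`. -/
lemma Zigzag.congr {n q p : ℕ} {h : p + q = n} {β γ : BiCochain k K L p q} {rest : Cochain k P n}
    (hβ : Zigzag f g q p h β rest) (e : diffH p q β = diffH p q γ) :
    Zigzag f g q p h γ rest := by
  cases q with
  | zero => exact ⟨e ▸ hβ.1, hβ.2⟩
  | succ q =>
    obtain ⟨β', rest', h1, h2⟩ := hβ
    exact ⟨β', rest', e ▸ h1, h2⟩

lemma zigzag_zero {n q p : ℕ} (h : p + q = n) :
    Zigzag f g q p h (0 : BiCochain k K L p q) 0 := by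
  induction q generalizing p with
  | zero => exact ⟨map_zero _, rfl⟩
  | succ q ih => exact ⟨0, 0, by simp, by simp, ih _⟩

lemma Zigzag.diffH_mem {n q p : ℕ} {h : p + q = n} {β : BiCochain k K L p q}
    {rest : Cochain k P n} (hβ : Zigzag f g q p h β rest) :
    diffH p q β ∈ columnBoundaries k K L (p + 1) q := by
  cases q with
  | zero => exact (Submodule.mem_bot k).2 hβ.1
  | succ q =>
    obtain ⟨β', _, h1, _⟩ := hβ
    rw [h1]
    exact Submodule.smul_mem _ _ ⟨β', rfl⟩

/-- For `q > 0`, write `β = inflate θ + diffV γ` with `θ` a sum of products of cocycles. Subtracting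
the total coboundary of `(-1)^p γ` removes `diffV γ` and changes the next component to `β' - (-1)^p
diffH γ`. Since `diffH ∘ diffH = 0`, that component still starts a zigzag, and `tensorDiffH θ = 0`
makes it a column cocycle, so induction on `q` applies. -/
lemma Zigzag.mem_crossSpan [∀ q, Module.Finite k (Coh k L q)] {n q p : ℕ} {h : p + q = n}
    {β : BiCochain k K L p q} {rest : Cochain k P n} (hβ : Zigzag f g q p h β rest)
    (hV : diffV p q β = 0) : totalize f g h β + rest ∈ crossSpan k f g n := by
  induction q generalizing p rest with
  | zero =>
    obtain ⟨θ, hθ, h1, -⟩ := exists_productCocycles β hV hβ.diffH_mem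
    rw [sub_eq_zero.1 ((Submodule.mem_bot k).1 h1), hβ.2, add_zero]
    exact totalize_productCocycles f g h θ hθ
  | succ q ih =>
    obtain ⟨θ, hθ, ⟨γ, hγ⟩, hdθ⟩ := exists_productCocycles β hV hβ.diffH_mem
    obtain ⟨β', rest', h1, rfl, h2⟩ := hβ
    obtain rfl : β = inflate p (q + 1) θ + diffV p q γ := by rw [hγ]; abel
    have hs : ((-1 : k) ^ p) * (-1) ^ p = 1 := by rw [← mul_pow]; simp
    have hH : diffH p (q + 1) (inflate p (q + 1) θ) = 0 := by
      rw [diffH_inflate, hdθ, map_zero]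
    have h3 := ih (β := β' - (-1 : k) ^ p • diffH p q γ) (h2.congr f g ?_) ?_
    · obtain rfl : n = p + q + 1 := by omega
      have h4 := coboundary_totalize f g (rfl : p + q = p + q) γ
      have h5 : totalize f g h (diffV p q γ) =
          (-1 : k) ^ p • coboundary k P (p + q) (totalize f g rfl γ) -
            (-1 : k) ^ p • totalize f g (by omega) (diffH p q γ) := by
        rw [h4, smul_add, smul_smul, hs, one_smul]
        abel
      rw [map_sub, map_smul] at h3
      have h6 : (-1 : k) ^ p • coboundary k P (p + q) (totalize f g rfl γ) ∈
          crossSpan k f g (p + q + 1) :=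
        Submodule.smul_mem _ _ (Submodule.mem_sup_left ⟨_, rfl⟩)
      have h7 := add_mem (add_mem (totalize_productCocycles f g h θ hθ) h6) h3
      rw [map_add, h5]
      convert h7 using 1
      abel
    · rw [map_sub, map_smul, diffH_diffH, smul_zero, sub_zero]
    · rw [map_add, hH, zero_add] at h1
      rw [map_sub, map_smul, diffV_diffH, h1, smul_smul, hs, one_smul, sub_self]

theorem cocycles_le_crossSpan [∀ q, Module.Finite k (Coh k L q)]
    (hP : ∀ n, Function.Bijective fun z : P.obj (op (.mk n)) => (f.app _ z, g.app _ z)) (n : ℕ) :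
    cocycles k P n ≤ crossSpan k f g n := by
  intro φ hφ
  have hp : ∀ n (σ : K.obj (op (.mk n))) (l : L.obj (op (.mk n))),
      ∃ z, f.app _ z = σ ∧ g.app _ z = l := fun n σ l => by
    obtain ⟨z, hz⟩ := (hP n).2 (σ, l)
    exact ⟨z, congrArg Prod.fst hz, congrArg Prod.snd hz⟩
  choose pair hpf hpg using hp
  have inj : ∀ {n} {z z' : P.obj (op (.mk n))}, f.app _ z = f.app _ z' → g.app _ z = g.app _ z' →
      z = z' := fun h1 h2 => (hP _).1 (Prod.ext h1 h2)
  have hpair : ∀ {m n : ℕ} (a : ℕ → ℕ) (σ : K.obj (op (.mk n))) (l : L.obj (op (.mk n))),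
      pair m (act m a σ) (act m a l) = act m a (pair n σ l) := fun a σ l =>
    inj (by rw [hpf, app_act, hpf]) (by rw [hpg, app_act, hpg])
  -- In column `0` the first block of `σ` is vertex `0` alone, and `β` ignores it. Hence `diffH β`
  -- is a difference of two equal terms, and `β` is a zigzag with no further components.
  let β : BiCochain k K L 0 n := fun σ l => φ (pair n (act n (1 + ·) σ) l)
  have hβ : totalize f g (zero_add n) β = φ := by
    funext z
    change φ (pair n (act n (1 + ·) (act (0 + n + 1) (dup 0) (f.app _ z)))
      (act n (0 + ·) (g.app _ z))) = φ z
    rw [act_act (c := id) (add_mono _) (dup_mono _) monotone_id (fun x hx =>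
      ⟨by omega, by simp only [dup, id]; grind⟩), act_self monotone_id fun _ _ => rfl,
      act_self (add_mono 0) fun x _ => zero_add x]
    exact congrArg φ (inj (hpf _ _ _) (hpg _ _ _))
  have hV : diffV 0 n β = 0 := by
    funext σ l
    have h1 := congrFun (LinearMap.mem_ker.1 hφ) (pair (n + 1) (act (n + 1) (1 + ·) σ) l)
    rw [coboundary_act] at h1
    refine (diffV_apply β σ l).trans (Eq.trans (Finset.sum_congr rfl fun i _ => ?_) h1)
    rw [← hpair]
    change _ * φ (pair n (act n (1 + ·) (act (0 + n + 1) (skip (0 + 1 + i)) σ)) _) = _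
    rw [act_act_eq (add_mono _) (skip_mono _) (skip_mono _) (add_mono _) (r := n + 1)
      (a' := skip i) (b' := (1 + ·)) (fun x hx => by simp only [skip]; grind)]
  have hH : diffH 0 n β = 0 := by
    funext σ l
    rw [diffH_apply, Finset.sum_range_succ, Finset.sum_range_one]
    change _ * φ (pair n (act n (1 + ·) (act (0 + n + 1) (skip 0) σ)) _) +
      _ * φ (pair n (act n (1 + ·) (act (0 + n + 1) (skip 1) σ)) _) = 0
    rw [act_act (c := (2 + ·)) (add_mono _) (skip_mono _) (add_mono _) (fun x hx =>
      ⟨by omega, by simp only [skip]; grind⟩), act_act (c := (2 + ·)) (add_mono _) (skip_mono _)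
      (add_mono _) (fun x hx => ⟨by omega, by simp only [skip]; grind⟩)]
    simp
  have := ((zigzag_zero f g (zero_add n)).congr f g
    (γ := β) (by rw [hH, map_zero])).mem_crossSpan f g hV
  rwa [add_zero, hβ] at this

/-- The surjectivity part of the Künneth theorem: the cohomology of `P = K × L` is spanned by the
cross products, if `L` has finite dimensional cohomology groups. -/
theorem span_cross_eq_top [∀ q, Module.Finite k (Coh k L q)]
    (hP : ∀ n, Function.Bijective fun z : P.obj (op (.mk n)) => (f.app _ z, g.app _ z)) (n : ℕ) :
    Submodule.span k {z | ∃ (p q : ℕ) (h : p + q = n) (a : Coh k K p) (b : Coh k L q),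
      z = cohMul k P h (cohMap k f p a) (cohMap k g q b)} = ⊤ := by
  refine top_le_iff.1 fun x _ => ?_
  induction x using coh_ind with | _ φ hφ
  obtain ⟨c, hc, d, hd, rfl⟩ := Submodule.mem_sup.1 (cocycles_le_crossSpan f g hP n hφ)
  have key : ∀ d ∈ Submodule.span k {z | ∃ (p q : ℕ) (h : p + q = n),
      ∃ a ∈ cocycles k K p, ∃ b ∈ cocycles k L q,
        z = cup k P h (cochainMap f p a) (cochainMap g q b)},
      ∃ hd : d ∈ cocycles k P n, cohMk d hd ∈ Submodule.span k {z | ∃ (p q : ℕ) (h : p + q = n)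
        (a : Coh k K p) (b : Coh k L q),
        z = cohMul k P h (cohMap k f p a) (cohMap k g q b)} := by
    intro d hd
    induction hd using Submodule.span_induction with
    | mem d hd =>
      obtain ⟨p, q, h, a, ha, b, hb, rfl⟩ := hd
      exact ⟨cup_mem_cocycles h (cochainMap_cocycles f p a ha) (cochainMap_cocycles g q b hb),
        Submodule.subset_span ⟨p, q, h, cohMk a ha, cohMk b hb, rfl⟩⟩
    | zero =>
      refine ⟨zero_mem _, ?_⟩
      convert zero_mem (Submodule.span k _) using 1
      exact map_zero (cohQ k P n)
    | add x y _ _ hx hy =>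
      obtain ⟨h1, h2⟩ := hx
      obtain ⟨h3, h4⟩ := hy
      exact ⟨add_mem h1 h3, add_mem h2 h4⟩
    | smul c x _ hx =>
      obtain ⟨h1, h2⟩ := hx
      exact ⟨Submodule.smul_mem _ c h1, Submodule.smul_mem _ c h2⟩
  obtain ⟨h1, h2⟩ := key d hd
  convert h2 using 1
  refine (Submodule.Quotient.eq _).2 ?_
  change c + d - d ∈ coboundaries k P n
  rwa [add_sub_cancel_right]

end Kunneth

/-! ### The cohomology algebra of a power -/

section Powers

variable {k : Type u} [Field k] {K L P : SSet.{w}}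

lemma cohMap_comp (f : P ⟶ K) (g : K ⟶ L) (n : ℕ) (x : Coh k L n) :
    cohMap k (f ≫ g) n x = cohMap k f n (cohMap k g n x) := by
  induction x using coh_ind with | _ φ hφ
  rfl

lemma lof_cohMul {p q n : ℕ} (h : p + q = n) (x : Coh k P p) (y : Coh k P q) :
    DirectSum.lof k ℕ (Coh k P) n (cohMul k P h x y) =
      DirectSum.lof k ℕ (Coh k P) p x * DirectSum.lof k ℕ (Coh k P) q y := by
  subst h
  exact (DirectSum.of_mul_of x y).symm

lemma cohMap_one (f : P ⟶ L) : cohMap k f 0 (cohOne k L) = cohOne k P := rfl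

/-- The pullbacks of the classes of positive degree along a family of maps. -/
def pullbacks (k : Type u) [Field k] {S : Type*} (e : S → (P ⟶ L)) : Set (⨁ n, Coh k P n) :=
  {y | ∃ (s : S) (i : ℕ) (a : Coh k L (i + 1)),
    y = DirectSum.lof k ℕ (Coh k P) (i + 1) (cohMap k (e s) (i + 1) a)}

lemma lof_zero_mem_adjoin (A : Subalgebra k (⨁ n, Coh k P n)) (x : Coh k P 0)
    (hx : x ∈ Submodule.span k {cohOne k P}) : DirectSum.lof k ℕ (Coh k P) 0 x ∈ A := by
  obtain ⟨c, rfl⟩ := Submodule.mem_span_singleton.1 hx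
  rw [map_smul]
  exact A.smul_mem A.one_mem c

lemma eq_top_of_lof_mem (A : Subalgebra k (⨁ n, Coh k P n))
    (h : ∀ n x, DirectSum.lof k ℕ (Coh k P) n x ∈ A) : A = ⊤ := by
  refine top_le_iff.1 fun x _ => ?_
  induction x using DirectSum.induction_on with
  | zero => exact zero_mem _
  | of n x => exact h n x
  | add x y hx hy => exact add_mem (hx trivial) (hy trivial)

lemma coh_point_zero (hP : ∀ n, Nonempty (Unique (P.obj (op (.mk n))))) (x : Coh k P 0) :
    x ∈ Submodule.span k {cohOne k P} := by
  obtain ⟨hu⟩ := hP 0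
  induction x using coh_ind with | _ φ hφ
  refine Submodule.mem_span_singleton.2 ⟨φ default, ?_⟩
  rw [cohOne, ← map_smul]
  congr 1
  ext1
  funext z
  change φ default * 1 = φ z
  rw [mul_one, Subsingleton.elim z default]

/-- With one simplex in each degree, the coboundary is multiplication by an alternating sum of ones,
that is `0` or `1`. For even `n` it is injective on degree `n + 1`; for odd `n` it maps onto degree
`n + 1`. -/
lemma coh_point_succ (hP : ∀ n, Nonempty (Unique (P.obj (op (.mk n))))) (n : ℕ)
    (x : Coh k P (n + 1)) : x = 0 := by
  obtain ⟨hu⟩ := hP n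
  obtain ⟨hu1⟩ := hP (n + 1)
  obtain ⟨hu2⟩ := hP (n + 2)
  have hs : ∀ j, ∑ i ∈ Finset.range j, (-1 : k) ^ i = if Even j then 0 else 1 := fun j => by
    induction j with
    | zero => simp
    | succ j ih =>
      rw [Finset.sum_range_succ, ih]
      rcases Nat.even_or_odd j with h | h
      · simp [h, h.neg_one_pow, Nat.even_add_one]
      · simp [h.neg_one_pow, Nat.even_add_one, Nat.not_even_iff_odd.2 h]
  induction x using coh_ind with | _ φ hφ
  refine (Submodule.Quotient.mk_eq_zero _).2 ?_
  change φ ∈ LinearMap.range (coboundary k P n)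
  rcases Nat.even_or_odd n with h | h
  · have := congrFun (LinearMap.mem_ker.1 hφ) default
    rw [coboundary_act, Finset.sum_congr rfl fun i _ => by
      rw [Subsingleton.elim (act (n + 1) (skip i) _) default], ← Finset.sum_mul, hs] at this
    have h0 : φ = 0 := by
      funext z
      rw [Subsingleton.elim z default]
      simpa [Nat.even_add_one, h, Nat.even_add] using this
    rw [h0]
    exact zero_mem _
  · refine ⟨fun _ => φ default, ?_⟩
    funext z
    rw [coboundary_act, ← Finset.sum_mul, hs, Subsingleton.elim z default]
    simp [Nat.even_add_one, Nat.not_even_iff_odd.2 h]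

/-- The powers of a simplicial set. -/
def powerSSet (L : SSet.{w}) (S : Type) : SSet.{w} where
  obj n := S → L.obj n
  map f := TypeCat.ofHom fun x s => L.map f (x s)
  map_id n := by
    ext x s
    exact Functor.map_id_apply L n (x s)
  map_comp f g := by
    ext x s
    exact Functor.map_comp_apply L f g (x s)

/-- The projections of a power of a simplicial set. -/
def powerProj (L : SSet.{w}) {S : Type} (s : S) : powerSSet L S ⟶ L where
  app n := TypeCat.ofHom fun x => x s

/-- The map to a power of a simplicial set with given components. -/
def powerLift {S : Type} (e : S → (P ⟶ L)) : P ⟶ powerSSet L S where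
  app n := TypeCat.ofHom fun z s => (e s).app n z
  naturality n m f := by
    ext z
    funext s
    exact NatTrans.naturality_apply (e s) f z

/-- The cohomology algebra of a finite power of `L` is generated by the pullbacks of the classes
of positive degree under the projections. -/
theorem adjoin_pullbacks_eq_top [∀ q, Module.Finite k (Coh k L q)]
    (h0 : ∀ x : Coh k L 0, x ∈ Submodule.span k {cohOne k L}) (S : Type) [Finite S] :
    ∀ (P : SSet.{w}) (e : S → (P ⟶ L)),
      (∀ n, Function.Bijective fun (z : P.obj (op (.mk n))) s => (e s).app _ z) →
        Algebra.adjoin k (pullbacks k e) = ⊤ := by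
  induction S using Finite.induction_empty_option with
  | of_equiv E ih =>
    intro P e he
    rw [← top_le_iff, ← ih P (e ∘ E) fun n => ?_]
    · refine Algebra.adjoin_mono ?_
      rintro _ ⟨s, i, a, rfl⟩
      exact ⟨E s, i, a, rfl⟩
    · exact (E.arrowCongr (Equiv.refl _)).symm.bijective.comp (he n)
  | h_empty =>
    intro P e he
    have hP : ∀ n, Nonempty (Unique (P.obj (op (.mk n)))) := fun n =>
      ⟨(Equiv.ofBijective _ (he n)).unique⟩
    refine eq_top_of_lof_mem _ fun n x => ?_
    cases n with
    | zero => exact lof_zero_mem_adjoin _ x (coh_point_zero hP x)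
    | succ n =>
      rw [coh_point_succ hP n x, map_zero]
      exact zero_mem _
  | h_option ih =>
    rename_i S _
    intro P e he
    -- `P` is the product of `powerSSet L S` and `L`, and quantifying over all `P` lets the
    -- induction hypothesis apply to `powerSSet L S`. Finite dimensionality is required of the
    -- factor `L` only.
    let f := powerLift fun s => e (some s)
    have hK := ih (powerSSet L S) (fun s => powerProj L s) fun n => Function.bijective_id
    have hf : ∀ n (a : Coh k (powerSSet L S) n),
        DirectSum.lof k ℕ (Coh k P) n (cohMap k f n a) ∈ Algebra.adjoin k (pullbacks k e) := by
      intro n a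
      have h1 : (⊤ : Subalgebra k (⨁ n, Coh k (powerSSet L S) n)) ≤
          (Algebra.adjoin k (pullbacks k e)).comap (cohAlgMap k f).toAlgHom := by
        rw [← hK, Algebra.adjoin_le_iff]
        rintro _ ⟨s, i, a, rfl⟩
        refine Algebra.subset_adjoin ⟨some s, i, a, ?_⟩
        refine (cohAlgMap_lof f _ _).trans ?_
        rw [← cohMap_comp]
        rfl
      have h2 := h1 (x := DirectSum.lof k ℕ _ n a) trivial
      rw [← cohAlgMap_lof]
      exact h2
    have hg : ∀ n (b : Coh k L n),
        DirectSum.lof k ℕ (Coh k P) n (cohMap k (e none) n b) ∈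
          Algebra.adjoin k (pullbacks k e) := by
      intro n b
      cases n with
      -- Degree `0` classes are not among the pullbacks; by `h0` they are multiples of the unit.
      | zero =>
        refine lof_zero_mem_adjoin _ _ ?_
        obtain ⟨c, rfl⟩ := Submodule.mem_span_singleton.1 (h0 b)
        rw [map_smul, cohMap_one]
        exact Submodule.smul_mem _ _ (Submodule.mem_span_singleton_self _)
      | succ n => exact Algebra.subset_adjoin ⟨none, n, b, rfl⟩
    have hbij : ∀ n, Function.Bijective fun z : P.obj (op (.mk n)) =>
        (f.app _ z, (e none).app _ z) := fun n => by
      refine ⟨fun z z' h => (he n).1 (funext fun s => ?_), fun y => ?_⟩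
      · cases s with
        | none => exact congrArg Prod.snd h
        | some s => exact congrFun (congrArg Prod.fst h) s
      · obtain ⟨z, hz⟩ := (he n).2 fun s => s.elim y.2 y.1
        exact ⟨z, Prod.ext (funext fun s => congrFun hz (some s)) (congrFun hz none)⟩
    refine eq_top_of_lof_mem _ fun n x => ?_
    have hx : x ∈ Submodule.span k {z | ∃ (p q : ℕ) (h : p + q = n) (a : Coh k (powerSSet L S) p)
        (b : Coh k L q), z = cohMul k P h (cohMap k f p a) (cohMap k (e none) q b)} := by
      rw [span_cross_eq_top f (e none) hbij n]
      trivial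
    induction hx using Submodule.span_induction with
    | mem x hx =>
      obtain ⟨p, q, h, a, b, rfl⟩ := hx
      rw [lof_cohMul]
      exact mul_mem (hf p a) (hg q b)
    | zero => rw [map_zero]; exact zero_mem _
    | add x y _ _ hx hy => rw [map_add]; exact add_mem hx hy
    | smul c x _ hx => rw [map_smul]; exact Subalgebra.smul_mem _ hx c

end Powers

/-! ### Singular cohomology of powers of a space -/

section Singular

variable {k : Type u} [Field k]

/-- A path is a singular `1`-simplex, on which the cocycle condition says that `φ` agrees at the two
endpoints. -/
lemma coh_zero_of_pathConnected (X : TopCat.{w}) [PathConnectedSpace X]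
    (x : Coh k (TopCat.toSSet.obj X) 0) : x ∈ Submodule.span k {cohOne k (TopCat.toSSet.obj X)} := by
  induction x using coh_ind with | _ φ hφ
  have key : ∀ a b : X, φ (TopCat.toSSetObj₀Equiv.symm a) = φ (TopCat.toSSetObj₀Equiv.symm b) := by
    intro a b
    let γ := PathConnectedSpace.somePath a b
    let p : TopCat.I ⟶ X := TopCat.ofHom ⟨fun t => γ t.down, by fun_prop⟩
    have h := congrFun (LinearMap.mem_ker.1 hφ) (TopCat.toSSetObj₁Equiv.symm p)
    change ∑ i : Fin 2, (-1 : k) ^ (i : ℕ) * φ ((TopCat.toSSet.obj X).δ i _) = 0 at h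
    rw [Fin.sum_univ_two, TopCat.δ_one_toSSetObj₁Equiv.symm,
      TopCat.δ_zero_toSSetObj₁Equiv.symm] at h
    have h0 : p 0 = a := γ.source
    have h1 : p 1 = b := γ.target
    rw [h0, h1] at h
    simp at h
    linear_combination -h
  obtain ⟨a⟩ : Nonempty X := inferInstance
  refine Submodule.mem_span_singleton.2 ⟨φ (TopCat.toSSetObj₀Equiv.symm a), ?_⟩
  rw [cohOne, ← map_smul]
  congr 1
  ext1
  funext z
  change φ _ * 1 = φ z
  rw [mul_one, key a (TopCat.toSSetObj₀Equiv z), Equiv.symm_apply_apply]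

/-- Singular simplices are maps out of standard simplices, so a product of spaces gives a product of
singular sets. The test spaces in `h` need only range over `Type`, where the standard simplices
live. -/
lemma toSSet_map_bijective {S : Type*} {Y X : TopCat.{w}} (e : S → (Y ⟶ X))
    (h : ∀ (Z : Type) [TopologicalSpace Z] (g : S → C(Z, X)), ∃ y : C(Z, Y), ∀ s z, e s (y z) = g s z)
    (hinj : ∀ y y' : Y, (∀ s, e s y = e s y') → y = y') (n : ℕ) :
    Function.Bijective fun (z : (TopCat.toSSet.obj Y).obj (op (.mk n))) s =>
      (TopCat.toSSet.map (e s)).app _ z := by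
  constructor
  · intro z z' hz
    refine (TopCat.toSSetObjEquiv Y _).injective (ContinuousMap.ext fun t => hinj _ _ fun s => ?_)
    exact DFunLike.congr_fun (congrArg (TopCat.toSSetObjEquiv X _) (congrFun hz s)) t
  · intro g
    obtain ⟨y, hy⟩ := h _ fun s => TopCat.toSSetObjEquiv X _ (g s)
    refine ⟨(TopCat.toSSetObjEquiv Y _).symm y, funext fun s =>
      (TopCat.toSSetObjEquiv X _).injective (ContinuousMap.ext fun t => hy s t)⟩

end Singular

/-! ### Generators of the cohomology of powers as a functor on `FI^m` -/

section Singular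

variable {k : Type u} [Field k] (X : Type w) [TopologicalSpace X] (x₀ : X) {m : ℕ}

/-- The coordinate projections of the powers of `X`. -/
def coordMap (d : FIm m) (j : Σ i, d i) :
    (coSpace X x₀ m).obj (op ((toSharpm m).obj d)) ⟶ TopCat.of X :=
  TopCat.ofHom ⟨fun v => v j.1 j.2, (continuous_apply j.2).comp (continuous_apply j.1)⟩

lemma coSpace_map_coordMap {c d : FIm m} (f : c ⟶ d) (j : Σ i, c i) :
    (coSpace X x₀ m).map ((toSharpm m).map f).op ≫ coordMap X x₀ c j =
      coordMap X x₀ d ⟨j.1, FIm.emb f j.1 j.2⟩ := rfl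

variable (k) in
/-- The functor `H^*(X^•; k)` on `FI^m`. -/
abbrev powersAlg (m : ℕ) : FIm m ⥤ GrAlg.{u, max u w} k :=
  toSharpm m ⋙ cohomologyPowers k X x₀ m

/-- The pullback of a class along a coordinate projection. -/
def coordClass (d : FIm m) (j : Σ i, d i) (n : ℕ) :
    Coh k (TopCat.toSSet.obj (TopCat.of X)) n →ₗ[k]
      ((powersAlg k X x₀ m ⋙ GrAlg.toGradedModule ⋙ GradedObject.eval n).obj d) :=
  LinearMap.codRestrict (cohDegree k _ n) (DirectSum.lof k ℕ (Coh k _) n ∘ₗ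
    cohMap k (TopCat.toSSet.map (coordMap X x₀ d j)) n) fun _ => ⟨_, rfl⟩

lemma map_coordClass {c d : FIm m} (f : c ⟶ d) (j : Σ i, c i) (n : ℕ)
    (a : Coh k (TopCat.toSSet.obj (TopCat.of X)) n) :
    ((powersAlg k X x₀ m ⋙ GrAlg.toGradedModule ⋙ GradedObject.eval n).map f).hom
      (coordClass X x₀ c j n a) = coordClass X x₀ d ⟨j.1, FIm.emb f j.1 j.2⟩ n a := by
  refine Subtype.ext ?_
  change cohAlgMap k (TopCat.toSSet.map ((coSpace X x₀ m).map ((toSharpm m).map f).op))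
    (DirectSum.lof k ℕ (Coh k _) n (cohMap k (TopCat.toSSet.map (coordMap X x₀ c j)) n a)) =
    DirectSum.lof k ℕ (Coh k _) n (cohMap k (TopCat.toSSet.map (coordMap X x₀ d _)) n a)
  rw [cohAlgMap_lof, ← cohMap_comp, ← Functor.map_comp, coSpace_map_coordMap]

/-- The submodule of `H^*(X^•; k)` spanned by the pullbacks of the classes of positive degree. -/
def coordClasses : ∀ n, SubMod (powersAlg k X x₀ m ⋙ GrAlg.toGradedModule ⋙ GradedObject.eval n)
  | 0 => ⟨fun _ => ⊥, fun f x hx => by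
      rw [(Submodule.mem_bot k).1 hx, map_zero]
      exact zero_mem _⟩
  | n + 1 => ⟨fun d => ⨆ j, LinearMap.range (coordClass X x₀ d j (n + 1)), fun {c d} f x hx => by
      change x ∈ Submodule.comap (ModuleCat.Hom.hom _) (⨆ j, LinearMap.range _)
      revert x
      change (⨆ j, LinearMap.range _) ≤ _
      refine iSup_le fun j => ?_
      rintro _ ⟨a, rfl⟩
      exact Submodule.mem_iSup_of_mem _ ⟨a, (map_coordClass X x₀ f j _ a).symm⟩⟩

lemma coordClass_mem (d : FIm m) (j : Σ i, d i) (n : ℕ)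
    (a : Coh k (TopCat.toSSet.obj (TopCat.of X)) (n + 1)) :
    coordClass X x₀ d j (n + 1) a ∈ (coordClasses X x₀ (n + 1)).carrier d :=
  Submodule.mem_iSup_of_mem j ⟨a, rfl⟩

/-- The object of `FI^m` with one element, in the component `i`. -/
def pointObj (i : Fin m) : FIm m := fun j => ⟨{_x : Unit // j = i}⟩

/-- The morphism from a one-element object with a given value. -/
def pointHom (d : FIm m) (j : Σ i, d i) : pointObj j.1 ⟶ d := fun i =>
  (⟨fun x => x.2 ▸ j.2, fun _ _ _ => Subtype.ext rfl⟩ : {_x : Unit // i = j.1} ↪ d i)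

lemma range_le_of_basis_mem {ι M N : Type*} [AddCommGroup M] [Module k M] [AddCommGroup N]
    [Module k N] (b : Module.Basis ι k M) (φ : M →ₗ[k] N) (N' : Submodule k N)
    (h : ∀ l, φ (b l) ∈ N') : LinearMap.range φ ≤ N' := by
  rw [LinearMap.range_eq_map, ← b.span_eq, Submodule.map_span, Submodule.span_le]
  rintro _ ⟨_, ⟨l, rfl⟩, rfl⟩
  exact h l

/-- The class `a` at coordinate `j` of `d` is the image under `pointHom d j` of `a` on a one-point
object. There are `m` such objects, and on each of them a finite basis suffices. -/
lemma finGen_coordClasses [∀ n, Module.Finite k (Coh k (TopCat.toSSet.obj (TopCat.of X)) n)]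
    (n : ℕ) : FinGen (coordClasses (k := k) (m := m) X x₀ n).toFunctor := by
  cases n with
  | zero => exact finGen_toFunctor _ ∅ Set.finite_empty (by simp) fun d => bot_le
  | succ n =>
    let b := Module.finBasis k (Coh k (TopCat.toSSet.obj (TopCat.of X)) (n + 1))
    refine finGen_toFunctor _ (Set.range fun p : Fin m × Fin _ =>
      ⟨pointObj p.1, coordClass X x₀ (pointObj p.1) ⟨p.1, ⟨(), rfl⟩⟩ (n + 1) (b p.2)⟩)
      (Set.finite_range _) ?_ fun d => ?_
    · rintro _ ⟨p, rfl⟩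
      exact coordClass_mem X x₀ _ _ n _
    · refine iSup_le fun j => range_le_of_basis_mem b _ _ fun l => ?_
      have h := map_coordClass X x₀ (pointHom d j) ⟨j.1, ⟨(), rfl⟩⟩ (n + 1) (b l)
      refine mem_span_orbit
        (V := powersAlg k X x₀ m ⋙ GrAlg.toGradedModule ⋙ GradedObject.eval (n + 1))
        (x := ⟨pointObj j.1, coordClass X x₀ (pointObj j.1) ⟨j.1, ⟨(), rfl⟩⟩ (n + 1) (b l)⟩)
        ?_ (pointHom d j) h
      exact ⟨(j.1, l), rfl⟩

/-- `X^d` is a product of copies of `X` indexed by `Σ i, d i`, and path-connectedness makes `H^0(X)`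
the span of the unit, so `adjoin_pullbacks_eq_top` applies. -/
lemma generatedBy_coordClasses [PathConnectedSpace X]
    [∀ n, Module.Finite k (Coh k (TopCat.toSSet.obj (TopCat.of X)) n)] :
    GeneratedBy (powersAlg k X x₀ m) (coordClasses X x₀) := by
  intro d
  have hS := adjoin_pullbacks_eq_top (k := k)
    (coh_zero_of_pathConnected (TopCat.of X)) (Σ i, d i) _
    (fun j => TopCat.toSSet.map (coordMap X x₀ d j))
    (toSSet_map_bijective (coordMap X x₀ d) (fun Z _ g =>
      ⟨⟨fun z i s => g ⟨i, s⟩ z, by fun_prop⟩, fun s z => rfl⟩)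
      (fun y y' h => funext fun i => funext fun s => h ⟨i, s⟩))
  refine top_le_iff.1 (hS.ge.trans (Algebra.adjoin_mono ?_))
  rintro _ ⟨j, i, a, rfl⟩
  exact ⟨i + 1, coordClass X x₀ d j (i + 1) a, coordClass_mem X x₀ d j i a, rfl⟩

lemma finite_coh {K : SSet.{w}} (n : ℕ) (h : Module.Finite k (cohDegree k K n)) :
    Module.Finite k (Coh k K n) :=
  have : Module.Finite k (LinearMap.range (DirectSum.lof k ℕ (Coh k K) n)) := h
  Module.Finite.equiv (LinearEquiv.ofInjective (DirectSum.lof k ℕ (Coh k K) n)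
    (DirectSum.of_injective n)).symm

theorem finiteType_cohomologyPowers (m : ℕ) [PathConnectedSpace X]
    (hX : ∀ i, Module.Finite k (((singularCohomology k).obj (op (TopCat.of X))).grading i)) :
    FiniteType (toSharpm m ⋙ cohomologyPowers k X x₀ m ⋙ GrAlg.toGradedModule) := by
  have : ∀ n, Module.Finite k (Coh k (TopCat.toSSet.obj (TopCat.of X)) n) := fun n =>
    finite_coh n (hX n)
  exact finiteType_of_generatedBy (powersAlg k X x₀ m) (coordClasses X x₀) (fun _ => rfl)
    (generatedBy_coordClasses X x₀) (finGen_coordClasses X x₀)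

end Singular

end FIRep

end

/-! ### The four finiteness statements together -/

theorem theorem2p7 (k : Type u) [Field k] [CharZero k] (m : ℕ) :
    (∀ (V : FIm m ⥤ ModuleCat.{v} k) (V' : FIm m ⥤ ModuleCat.{w} k),
      FinGen V → FinGen V' → FinGen (tensor V V')) ∧
    (∀ (A : FIm m ⥤ GrAlg.{u, v} k), (∀ d, (A.obj d).IsGradedCommutative) →
      ∀ V : (∀ i : ℕ, SubMod (A ⋙ GrAlg.toGradedModule ⋙ GradedObject.eval i)),
        (∀ d, (V 0).carrier d = ⊥) → GeneratedBy A V → (∀ i, FinGen (V i).toFunctor) →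
          FiniteType (A ⋙ GrAlg.toGradedModule)) ∧
    (∀ (W : Type v) [AddCommGroup W] [Module k W] (𝒱 : ℕ → Submodule k W)
      [DirectSum.Decomposition 𝒱] (e : 𝒱 0 ≃ₗ[k] k),
        (∀ i, Module.Finite k (𝒱 i)) → FiniteType (toSharpm m ⋙ tensorPowers 𝒱 e m)) ∧
    (∀ (X : Type w) [TopologicalSpace X] [PathConnectedSpace X] (x₀ : X),
      (∀ i, Module.Finite k (((singularCohomology k).obj (op (TopCat.of X))).grading i)) →
        (∀ d, ((cohomologyPowers k X x₀ m).obj d).IsGradedCommutative) ∧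
          FiniteType (toSharpm m ⋙ cohomologyPowers k X x₀ m ⋙ GrAlg.toGradedModule)) := by
  refine ⟨fun _ _ => finGen_tensor, fun A _ V => finiteType_of_generatedBy A V,
    fun W _ _ 𝒱 _ e => finiteType_tensorPowers m 𝒱 e, fun X _ _ x₀ hX =>
      ⟨fun d => isGradedCommutative_cohAlg _, finiteType_cohomologyPowers X x₀ m hX⟩⟩
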